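/- All rings are commutative with identity. A ring is *coherent* if each of its finitely generated ideals is finitely presented. For a ring $A$ and an $A$-module $M$ put $M^*=\operatorname{Hom}_A(M,A)$. The *G-class* $\mathrm{G}(A)$ consists of the finitely generated $A$-modules $M$ such that $\operatorname{Ext}^i_A(M,A)=0$ and $\operatorname{Ext}^i_A(M^*,A)=0$ for all $i>0$, and the natural map $M\to M^{**}$ is an isomorphism. A *G-resolution* of an $A$-module $M$ is an exact sequence $\cdots\to G_1\to G_0\to M\to 0$ with every $G_i$ in $\mathrm{G}(A)$; its length is the supremum of the $n$ with $G_n\neq 0$ (and $0$ if all $G_n$ vanish). The *G-dimension* of $M$ is the infimum of the lengths of all G-resolutions of $M$; it is finite if and only if $M$ has a G-resolution of finite length. A quasi-local ring (a ring with exactly one maximal ideal) is *Gorenstein* if every finitely generated ideal has finite G-dimension, and an arbitrary ring $A$ is *Gorenstein* if the localization $A_{\mathfrak m}$ is Gorenstein for every maximal ideal $\mathfrak m$ of $A$. **Theorem.** Let $R$ be a commutative ring and $R[x]$ the polynomial ring in one indeterminate over $R$, and assume that $R[x]$ is coherent. Then $R$ is Gorenstein if and only if $R[x]$ is Gorenstein.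 -/

import Mathlib

namespace CohGor

universe u

open CategoryTheory

/-- A commutative ring is coherent if every finitely generated ideal is finitely presented. -/
def IsCoherent (R : Type u) [CommRing R] : Prop :=
  ∀ I : Ideal R, I.FG → Module.FinitePresentation R I

/-- The G-class of `R`: finitely generated modules `M` with `Ext^i(M, R) = 0` and
`Ext^i(M^*, R) = 0` for all `i > 0`, and such that the natural map `M → M^{**}` is
an isomorphism. -/
structure GClass (R : Type u) [CommRing R] (M : Type u) [AddCommGroup M] [Module R M] :
    Prop where
  finite : Module.Finite R M
  ext_eq_zero : ∀ i : ℕ, 0 < i →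
    Subsingleton (Abelian.Ext.{u} (ModuleCat.of R M) (ModuleCat.of R R) i)
  ext_dual_eq_zero : ∀ i : ℕ, 0 < i →
    Subsingleton (Abelian.Ext.{u} (ModuleCat.of R (Module.Dual R M)) (ModuleCat.of R R) i)
  bijective_eval : Function.Bijective (Module.Dual.eval R M)

/-- A G-resolution of `M`: an exact sequence `⋯ → G₂ → G₁ → G₀ → M → 0` of `R`-modules
with every `Gᵢ` in the G-class of `R`. -/
structure GResolution (R : Type u) [CommRing R] (M : Type u) [AddCommGroup M] [Module R M] where
  G : ℕ → ModuleCat.{u} R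
  d : ∀ i : ℕ, G (i + 1) →ₗ[R] G i
  aug : G 0 →ₗ[R] M
  mem_gClass : ∀ i : ℕ, GClass R (G i)
  aug_surjective : Function.Surjective aug
  exact_zero : Function.Exact (d 0) aug
  exact_succ : ∀ i : ℕ, Function.Exact (d (i + 1)) (d i)

/-- The length of a G-resolution: the supremum of the `n` with `Gₙ ≠ 0`; it is `0` if there is
no such `n`. -/
noncomputable def GResolution.length {R : Type u} [CommRing R] {M : Type u} [AddCommGroup M]
    [Module R M] (P : GResolution R M) : ℕ∞ :=
  ⨆ (n : ℕ) (_ : Nontrivial (P.G n)), (n : ℕ∞)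

/-- The G-dimension of `M`: the infimum of the lengths of all G-resolutions of `M`.
A module without any G-resolution gets the value `⊤` and so is not of finite G-dimension. -/
noncomputable def gDim (R : Type u) [CommRing R] (M : Type u) [AddCommGroup M] [Module R M] :
    ℕ∞ :=
  ⨅ P : GResolution R M, P.length

/-- A quasi-local ring (a commutative ring with a unique maximal ideal) is Gorenstein if every
finitely generated ideal has finite G-dimension. -/
def IsQuasiLocalGorenstein (R : Type u) [CommRing R] [IsLocalRing R] : Prop :=
  ∀ I : Ideal R, I.FG → gDim R I < ⊤

/-- A commutative ring is Gorenstein if its localization at every maximal ideal is. -/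
def IsGorenstein (R : Type u) [CommRing R] : Prop :=
  ∀ (m : Ideal R) [m.IsMaximal], IsQuasiLocalGorenstein (Localization.AtPrime m)

end CohGor

/-! Over a coherent ring a finitely presented module has finite G-dimension exactly when some syzygy
of it, taken along finitely generated projectives, lies in the G-class. This is the predicate `GD`.
A Schanuel argument (`GD.ker`) shows that it does not depend on the projectives chosen, and
`HasGRes.gd` and `GD.gDim_lt_top` link it to `gDim`. It is stable under extensions and localization,
so finiteness for finitely generated ideals implies finiteness for all finitely presented modules
(`FinGDimIdeals.exists_gd`).

The heart is a change of rings. Let `f` be regular in an `A`-algebra `B`, with `S = B/fB` finite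
free and Frobenius over `A`. If `f` is regular on `M` and `Ext^1_B(M, B) = 0`, then `Hom_B(M, B)/f`
is `Hom_S(M/fM, S)`, which the Frobenius form identifies with `Hom_A(M/fM, A)`. Hence the G-class
passes from `M` to `M/fM`. It lifts back by Nakayama if `f` lies in the Jacobson radical.

Ascent: for a maximal ideal `n` of `R[X]` over `p`, put `A = R_p`. The maximal ideal of `A[X]`
induced by `n` is generated by the maximal ideal of `A` and a monic `f`. The localization `B` there
has `B/fB = A[X]/(f)`, a monogenic and hence Frobenius algebra. For a finitely generated ideal `I`
of `B`, the `A`-module `I/fI` has finite G-dimension, and this lifts to `I`.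

Descent: with `A = R_m`, localize `A[X]` at the ideal generated by the maximal ideal and `X`, and
take `f = X`. An ideal `J` of `A` is the reduction modulo `X` of its extension. -/

namespace CohGor
open CategoryTheory
universe u

/-! ### Vanishing of Ext into the ring, by dimension shifting. -/

section Perp

variable (A : Type u) [CommRing A]

/-- The module `Ext^i(M, A)` vanishes. -/
abbrev ExtVanish (M : Type u) [AddCommGroup M] [Module A M] (i : ℕ) : Prop :=
  Subsingleton (Abelian.Ext.{u} (ModuleCat.of A M) (ModuleCat.of A A) i)

/-- All higher extension modules of `M` by `A` vanish. -/
def Perp (M : Type u) [AddCommGroup M] [Module A M] : Prop :=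
  ∀ i : ℕ, 0 < i → ExtVanish A M i

variable {A}
variable {K E G : Type u} [AddCommGroup K] [Module A K] [AddCommGroup E] [Module A E]
  [AddCommGroup G] [Module A G]

theorem Perp.of_projective [Module.Projective A E] : Perp A E := by
  intro i hi
  obtain ⟨n, rfl⟩ := Nat.exists_eq_succ_of_ne_zero hi.ne'
  have : Projective (ModuleCat.of A E) := ModuleCat.projective_of_categoryTheory_projective _
  exact Abelian.Ext.subsingleton_of_projective _ _ _

theorem Perp.of_equiv (e : E ≃ₗ[A] G) (h : Perp A E) : Perp A G := by
  intro i hi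
  have := h i hi
  refine ⟨fun x y => ?_⟩
  have key : ∀ z : Abelian.Ext.{u} (ModuleCat.of A G) (ModuleCat.of A A) i, z = 0 := by
    intro z
    have h1 : (Abelian.Ext.mk₀ (ModuleCat.ofHom e.toLinearMap)).comp z (zero_add i) = 0 :=
      Subsingleton.elim _ _
    have h2 : (Abelian.Ext.mk₀ (ModuleCat.ofHom e.symm.toLinearMap)).comp
        ((Abelian.Ext.mk₀ (ModuleCat.ofHom e.toLinearMap)).comp z (zero_add i)) (zero_add i)
        = z := by
      have h3 : ModuleCat.ofHom e.symm.toLinearMap ≫ ModuleCat.ofHom e.toLinearMap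
          = 𝟙 (ModuleCat.of A G) := by
        ext x
        simp
      rw [Abelian.Ext.mk₀_comp_mk₀_assoc, h3, Abelian.Ext.mk₀_id_comp]
    rw [← h2, h1, Abelian.Ext.comp_zero]
  rw [key x, key y]

variable {f : K →ₗ[A] E} {g : E →ₗ[A] G}

theorem shortExact_of_exact (hf : Function.Injective f) (hg : Function.Surjective g)
    (h : Function.Exact f g) :
    (ModuleCat.shortComplexOfCompEqZero f g h.linearMap_comp_eq_zero).ShortExact :=
  ModuleCat.shortComplex_shortExact _ h hf hg

/-- `Ext^i(K, A)` sits between `Ext^i(E, A)` and `Ext^(i+1)(G, A)`. -/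
theorem Perp.left (hf : Function.Injective f) (hg : Function.Surjective g)
    (h : Function.Exact f g) (hE : Perp A E) (hG : Perp A G) : Perp A K := by
  intro i hi
  have h1 := hE i hi
  have h2 := hG (1 + i) (by omega)
  have key : ∀ z : Abelian.Ext.{u} (ModuleCat.of A K) (ModuleCat.of A A) i, z = 0 := by
    intro z
    obtain ⟨w, rfl⟩ := Abelian.Ext.contravariant_sequence_exact₁
      (shortExact_of_exact hf hg h) (ModuleCat.of A A) z rfl (Subsingleton.elim _ _)
    rw [Subsingleton.elim w 0, Abelian.Ext.comp_zero]
  exact ⟨fun x y => by rw [key x, key y]⟩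

theorem Perp.middle (hf : Function.Injective f) (hg : Function.Surjective g)
    (h : Function.Exact f g) (hK : Perp A K) (hG : Perp A G) : Perp A E := by
  intro i hi
  have h1 := hK i hi
  have h2 := hG i hi
  have key : ∀ z : Abelian.Ext.{u} (ModuleCat.of A E) (ModuleCat.of A A) i, z = 0 := by
    intro z
    obtain ⟨w, rfl⟩ := Abelian.Ext.contravariant_sequence_exact₂
      (shortExact_of_exact hf hg h) (ModuleCat.of A A) z (Subsingleton.elim _ _)
    rw [Subsingleton.elim w 0, Abelian.Ext.comp_zero]
  exact ⟨fun x y => by rw [key x, key y]⟩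

theorem ExtVanish.succ (hf : Function.Injective f) (hg : Function.Surjective g)
    (h : Function.Exact f g) {i : ℕ} (hK : ExtVanish A K i) (hE : ExtVanish A E (i + 1)) :
    ExtVanish A G (i + 1) := by
  have key : ∀ z : Abelian.Ext.{u} (ModuleCat.of A G) (ModuleCat.of A A) (i + 1), z = 0 := by
    intro z
    obtain ⟨w, rfl⟩ := Abelian.Ext.contravariant_sequence_exact₃
      (shortExact_of_exact hf hg h) (ModuleCat.of A A) z (Subsingleton.elim _ _) (add_comm 1 i)
    rw [Subsingleton.elim w 0, Abelian.Ext.comp_zero]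
  exact ⟨fun x y => by rw [key x, key y]⟩

/-- When `Ext^1(E, A) = 0`, `Ext^1(G, A)` is the cokernel of the restriction of linear forms from
`E` to `K`. With `ExtVanish.succ`, this reduces the later vanishing proofs to extending linear
forms. -/
theorem ExtVanish.one (hf : Function.Injective f) (hg : Function.Surjective g)
    (h : Function.Exact f g) (hE : ExtVanish A E 1)
    (hd : ∀ φ : K →ₗ[A] A, ∃ ψ : E →ₗ[A] A, ψ ∘ₗ f = φ) :
    ExtVanish A G 1 := by
  have key : ∀ z : Abelian.Ext.{u} (ModuleCat.of A G) (ModuleCat.of A A) 1, z = 0 := by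
    intro z
    have se := shortExact_of_exact hf hg h
    obtain ⟨w, rfl⟩ := Abelian.Ext.contravariant_sequence_exact₃
      se (ModuleCat.of A A) z (Subsingleton.elim _ _) (add_zero 1)
    obtain ⟨φ, rfl⟩ := (Abelian.Ext.mk₀_bijective _ _).2 w
    obtain ⟨ψ, hψ⟩ := hd φ.hom
    have h4 : φ = ModuleCat.ofHom f ≫ ModuleCat.ofHom ψ := by
      ext x
      simp [← hψ]
    rw [h4, ← Abelian.Ext.mk₀_comp_mk₀]
    exact se.extClass_comp_assoc _
  exact ⟨fun x y => by rw [key x, key y]⟩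

theorem ExtVanish.exists_extend (hf : Function.Injective f) (hg : Function.Surjective g)
    (h : Function.Exact f g) (hG : ExtVanish A G 1) (φ : K →ₗ[A] A) :
    ∃ ψ : E →ₗ[A] A, ψ ∘ₗ f = φ := by
  obtain ⟨w, hw⟩ := Abelian.Ext.contravariant_sequence_exact₁
      (shortExact_of_exact hf hg h) (ModuleCat.of A A) (Abelian.Ext.mk₀ (ModuleCat.ofHom φ))
      (add_zero 1) (Subsingleton.elim _ _)
  obtain ⟨ψ, rfl⟩ := (Abelian.Ext.mk₀_bijective _ _).2 w
  rw [Abelian.Ext.mk₀_comp_mk₀] at hw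
  have := (Abelian.Ext.mk₀_bijective _ _).1 hw
  refine ⟨ψ.hom, ?_⟩
  have h5 := congrArg ModuleCat.Hom.hom this
  simpa using h5

theorem Perp.right (hf : Function.Injective f) (hg : Function.Surjective g)
    (h : Function.Exact f g) (hK : Perp A K) (hE : Perp A E)
    (hd : ∀ φ : K →ₗ[A] A, ∃ ψ : E →ₗ[A] A, ψ ∘ₗ f = φ) : Perp A G := by
  intro i hi
  obtain ⟨n, rfl⟩ := Nat.exists_eq_succ_of_ne_zero hi.ne'
  rcases Nat.eq_zero_or_pos n with rfl | hn
  · exact ExtVanish.one hf hg h (hE 1 one_pos) hd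
  · exact ExtVanish.succ hf hg h (hK n hn) (hE _ hi)

end Perp

/-! ### Closure properties of the G-class. -/

section GClass

variable {A : Type u} [CommRing A]

theorem gClass_iff (M : Type u) [AddCommGroup M] [Module A M] :
    GClass A M ↔ Module.Finite A M ∧ Perp A M ∧ Perp A (Module.Dual A M) ∧
      Function.Bijective (Module.Dual.eval A M) :=
  ⟨fun h => ⟨h.1, h.2, h.3, h.4⟩, fun h => ⟨h.1, h.2.1, h.2.2.1, h.2.2.2⟩⟩

variable {K E G : Type u} [AddCommGroup K] [Module A K] [AddCommGroup E] [Module A E]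
  [AddCommGroup G] [Module A G]

theorem GClass.of_projective [Module.Finite A E] [Module.Projective A E] : GClass A E :=
  (gClass_iff E).2 ⟨inferInstance, .of_projective, .of_projective,
    Module.bijective_dual_eval A E⟩

theorem GClass.of_equiv (e : E ≃ₗ[A] G) (h : GClass A E) : GClass A G := by
  rw [gClass_iff] at h ⊢
  obtain ⟨h1, h2, h3, h4⟩ := h
  refine ⟨.equiv e, h2.of_equiv e, h3.of_equiv e.symm.dualMap, ?_⟩
  have : Module.IsReflexive A E := ⟨h4⟩
  exact (Module.equiv e).1

variable {f : K →ₗ[A] E} {g : E →ₗ[A] G}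

theorem exact_dualMap (hg : Function.Surjective g) (h : Function.Exact f g) :
    Function.Exact g.dualMap f.dualMap :=
  LinearMap.exact_lcomp_of_exact_of_surjective A h hg

theorem dualMap_surjective (hf : Function.Injective f) (hg : Function.Surjective g)
    (h : Function.Exact f g) (hG : Perp A G) : Function.Surjective f.dualMap := fun φ =>
  (hG 1 one_pos).exists_extend hf hg h φ

theorem eval_naturality (g : E →ₗ[A] G) (x : E) :
    g.dualMap.dualMap (Module.Dual.eval A E x) = Module.Dual.eval A G (g x) := rfl

/-- The kernel of a surjection between modules of the G-class is in the G-class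
if it is finitely generated. -/
theorem GClass.left [Module.Finite A K] (hf : Function.Injective f) (hg : Function.Surjective g)
    (h : Function.Exact f g) (hE : GClass A E) (hG : GClass A G) : GClass A K := by
  rw [gClass_iff] at hE hG ⊢
  obtain ⟨-, hE2, hE3, hE4⟩ := hE
  obtain ⟨-, hG2, hG3, hG4⟩ := hG
  have sf := dualMap_surjective hf hg h hG2
  have ig : Function.Injective g.dualMap := LinearMap.dualMap_injective_of_surjective hg
  have ex := exact_dualMap hg h
  -- Biduality on `G` is onto, hence so is the bidual of `g`. This is the extension hypothesis of
  -- `Perp.right` for the dual sequence.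
  have hgg : Function.Surjective g.dualMap.dualMap := fun y => by
    obtain ⟨z, rfl⟩ := hG4.2 y
    obtain ⟨x, rfl⟩ := hg z
    exact ⟨_, eval_naturality g x⟩
  have iff' : Function.Injective f.dualMap.dualMap := LinearMap.dualMap_injective_of_surjective sf
  have exx := exact_dualMap sf ex
  refine ⟨inferInstance, hE2.left hf hg h hG2, Perp.right ig sf ex hG3 hE3 hgg, ?_, ?_⟩
  · intro x y hxy
    apply hf
    apply hE4.1
    rw [← eval_naturality, ← eval_naturality, hxy]
  · intro ξ
    obtain ⟨e, he⟩ := hE4.2 (f.dualMap.dualMap ξ)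
    have : g e = 0 := by
      apply hG4.1
      rw [← eval_naturality, he, (exx _).2 ⟨ξ, rfl⟩, map_zero]
    obtain ⟨k, rfl⟩ := (h e).1 this
    refine ⟨k, iff' ?_⟩
    rw [eval_naturality, he]

/-- The G-class is closed under extensions. -/
theorem GClass.middle (hf : Function.Injective f) (hg : Function.Surjective g)
    (h : Function.Exact f g) (hK : GClass A K) (hG : GClass A G) : GClass A E := by
  rw [gClass_iff] at hK hG ⊢
  obtain ⟨hK1, hK2, hK3, hK4⟩ := hK
  obtain ⟨hG1, hG2, hG3, hG4⟩ := hG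
  have sf := dualMap_surjective hf hg h hG2
  have ig : Function.Injective g.dualMap := LinearMap.dualMap_injective_of_surjective hg
  have ex := exact_dualMap hg h
  have exx := exact_dualMap sf ex
  have iff' : Function.Injective f.dualMap.dualMap := LinearMap.dualMap_injective_of_surjective sf
  refine ⟨Module.Finite.of_exact h hg, hK2.middle hf hg h hG2,
    Perp.middle ig sf ex hG3 hK3, ?_, ?_⟩
  · rw [injective_iff_map_eq_zero]
    intro x hx
    have : g x = 0 := by
      apply hG4.1
      rw [← eval_naturality, hx, map_zero, map_zero]
    obtain ⟨k, rfl⟩ := (h x).1 this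
    have : k = 0 := by
      apply hK4.1
      apply iff'
      rw [eval_naturality, hx, map_zero, map_zero]
    rw [this, map_zero]
  · intro ξ
    obtain ⟨z, hz⟩ := hG4.2 (g.dualMap.dualMap ξ)
    obtain ⟨x, rfl⟩ := hg z
    have : g.dualMap.dualMap (ξ - Module.Dual.eval A E x) = 0 := by
      rw [map_sub, eval_naturality, hz, sub_self]
    obtain ⟨η, hη⟩ := (exx _).1 this
    obtain ⟨k, rfl⟩ := hK4.2 η
    refine ⟨x + f k, ?_⟩
    rw [map_add, ← eval_naturality, hη]
    abel

end GClass

/-! ### Exact sequences, finite presentation and pullbacks. -/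

section Exact

variable {A : Type u} [CommRing A]
variable {K E G : Type u} [AddCommGroup K] [Module A K] [AddCommGroup E] [Module A E]
  [AddCommGroup G] [Module A G]
variable {f : K →ₗ[A] E} {g : E →ₗ[A] G}

theorem nonempty_equiv_ker (hf : Function.Injective f) (h : Function.Exact f g) :
    Nonempty (K ≃ₗ[A] LinearMap.ker g) :=
  ⟨LinearEquiv.ofInjective f hf ≪≫ₗ LinearEquiv.ofEq _ _ h.linearMap_ker_eq.symm⟩

theorem nonempty_equiv_prod [Module.Projective A G] (hf : Function.Injective f)
    (hg : Function.Surjective g) (h : Function.Exact f g) : Nonempty (E ≃ₗ[A] K × G) := by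
  obtain ⟨l, hl⟩ := Module.projective_lifting_property g LinearMap.id hg
  exact ⟨(h.splitSurjectiveEquiv hf ⟨l, hl⟩).1⟩

theorem finitePresentation_of_exact (hf : Function.Injective f) (hg : Function.Surjective g)
    (h : Function.Exact f g) [Module.FinitePresentation A K] [Module.FinitePresentation A G] :
    Module.FinitePresentation A E := by
  obtain ⟨e⟩ := nonempty_equiv_ker hf h
  have : Module.FinitePresentation A (LinearMap.ker g) := .of_equiv e
  exact Module.finitePresentation_of_ker g hg

theorem finitePresentation_right_of_exact (hg : Function.Surjective g)
    (h : Function.Exact f g) [Module.Finite A K] [Module.FinitePresentation A E] :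
    Module.FinitePresentation A G := by
  refine Module.finitePresentation_of_surjective g hg ?_
  rw [h.linearMap_ker_eq]
  exact Module.Finite.iff_fg.1 inferInstance

theorem exact_ker_subtype (g : E →ₗ[A] G) : Function.Exact (LinearMap.ker g).subtype g :=
  LinearMap.exact_subtype_ker_map g

/-- Two surjections onto `M` with kernels `K` and `K'` have a pullback which is an
extension in two ways. -/
theorem exists_pullback {M F F' : Type u} [AddCommGroup M] [Module A M] [AddCommGroup F]
    [Module A F] [AddCommGroup F'] [Module A F'] {p : F →ₗ[A] M} {p' : F' →ₗ[A] M}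
    (hp : Function.Surjective p) (hp' : Function.Surjective p') :
    ∃ (Q : Type u) (_ : AddCommGroup Q) (_ : Module A Q)
      (i : LinearMap.ker p →ₗ[A] Q) (j : Q →ₗ[A] F')
      (i' : LinearMap.ker p' →ₗ[A] Q) (j' : Q →ₗ[A] F),
      Function.Injective i ∧ Function.Surjective j ∧ Function.Exact i j ∧
      Function.Injective i' ∧ Function.Surjective j' ∧ Function.Exact i' j' := by
  let Q := LinearMap.ker (p.coprod (-p'))
  have hQ : ∀ z, z ∈ Q ↔ p z.1 = p' z.2 := fun z => by
    simp [Q, LinearMap.mem_ker, ← sub_eq_add_neg, sub_eq_zero]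
  refine ⟨Q, inferInstance, inferInstance,
    LinearMap.codRestrict Q (LinearMap.inl A F F' ∘ₗ (LinearMap.ker p).subtype) fun x => ?_,
    LinearMap.snd A F F' ∘ₗ Q.subtype,
    LinearMap.codRestrict Q (LinearMap.inr A F F' ∘ₗ (LinearMap.ker p').subtype) fun x => ?_,
    LinearMap.fst A F F' ∘ₗ Q.subtype, ?_, ?_, ?_, ?_, ?_, ?_⟩
  · rw [hQ]; simp
  · rw [hQ]; simp
  · intro x y hxy
    exact Subtype.ext (congrArg (fun z : Q => (z : F × F').1) hxy)
  · intro y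
    obtain ⟨x, hx⟩ := hp (p' y)
    exact ⟨⟨(x, y), (hQ _).2 hx⟩, rfl⟩
  · rintro ⟨⟨x, y⟩, hz⟩
    rw [hQ] at hz
    constructor
    · intro h0
      have h0 : y = 0 := h0
      subst h0
      exact ⟨⟨x, by simpa using hz⟩, rfl⟩
    · rintro ⟨w, hw⟩
      have := congrArg (fun z : Q => (z : F × F').2) hw
      exact this.symm
  · intro x y hxy
    exact Subtype.ext (congrArg (fun z : Q => (z : F × F').2) hxy)
  · intro x
    obtain ⟨y, hy⟩ := hp' (p x)
    exact ⟨⟨(x, y), (hQ _).2 hy.symm⟩, rfl⟩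
  · rintro ⟨⟨x, y⟩, hz⟩
    rw [hQ] at hz
    constructor
    · intro h0
      have h0 : x = 0 := h0
      subst h0
      exact ⟨⟨y, by simpa using hz.symm⟩, rfl⟩
    · rintro ⟨w, hw⟩
      have := congrArg (fun z : Q => (z : F × F').1) hw
      exact this.symm

end Exact

/-! ### Syzygies in the G-class. -/

section GD

/-- `GD A n M`: an `n`-th syzygy of `M` by finitely generated projective modules is finitely
presented and belongs to the G-class. -/
def GD (A : Type u) [CommRing A] : ℕ → ∀ (M : Type u) [AddCommGroup M] [Module A M], Prop
  | 0, M, _, _ => Module.FinitePresentation A M ∧ GClass A M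
  | n + 1, M, _, _ => ∃ (F : Type u) (_ : AddCommGroup F) (_ : Module A F)
      (_ : Module.Finite A F) (_ : Module.Projective A F) (p : F →ₗ[A] M),
      Function.Surjective p ∧ GD A n (LinearMap.ker p)

variable {A : Type u} [CommRing A]
variable {K E G M P : Type u} [AddCommGroup K] [Module A K] [AddCommGroup E] [Module A E]
  [AddCommGroup G] [Module A G] [AddCommGroup M] [Module A M] [AddCommGroup P] [Module A P]
variable {f : K →ₗ[A] E} {g : E →ₗ[A] G}

theorem GD.of_equiv {n : ℕ} (e : E ≃ₗ[A] G) (h : GD A n E) : GD A n G := by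
  cases n with
  | zero => exact ⟨have := h.1; .of_equiv e, h.2.of_equiv e⟩
  | succ n =>
    obtain ⟨F, _, _, hF, hF', p, hp, h⟩ := h
    refine ⟨F, _, _, hF, hF', e.toLinearMap ∘ₗ p, e.surjective.comp hp, ?_⟩
    rw [LinearEquiv.ker_comp]
    exact h

theorem GD.succ_of_exact {n : ℕ} [Module.Finite A E] [Module.Projective A E]
    (hf : Function.Injective f) (hg : Function.Surjective g) (h : Function.Exact f g)
    (hK : GD A n K) : GD A (n + 1) G := by
  obtain ⟨e⟩ := nonempty_equiv_ker hf h
  exact ⟨E, _, _, inferInstance, inferInstance, g, hg, hK.of_equiv e⟩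

theorem GD.finitePresentation {n : ℕ} (h : GD A n M) : Module.FinitePresentation A M := by
  induction n generalizing M with
  | zero => exact h.1
  | succ n ih =>
    obtain ⟨F, _, _, hF, hF', p, hp, h⟩ := h
    have := ih h
    have := Module.finitePresentation_of_projective A F
    exact finitePresentation_right_of_exact hp (exact_ker_subtype p)

theorem exact_inl_snd_prodMap (p : E →ₗ[A] K) :
    Function.Exact (LinearMap.inl A E P ∘ₗ (LinearMap.ker p).subtype)
      (p.prodMap (LinearMap.id : P →ₗ[A] P)) := by
  rintro ⟨x, y⟩
  constructor
  · intro h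
    simp only [LinearMap.prodMap_apply, LinearMap.id_apply, Prod.mk_eq_zero] at h
    exact ⟨⟨x, h.1⟩, by simp [h.2]⟩
  · rintro ⟨z, hz⟩
    simp only [LinearMap.comp_apply, LinearMap.inl_apply, Prod.mk.injEq] at hz
    simp [← hz.1, ← hz.2]

theorem GClass.prod [Module.Finite A P] [Module.Projective A P] (h : GClass A K) :
    GClass A (K × P) :=
  GClass.middle (f := LinearMap.inl A K P) (g := LinearMap.snd A K P) LinearMap.inl_injective
    LinearMap.snd_surjective .inl_snd h .of_projective

theorem GD.prod {n : ℕ} [Module.Finite A P] [Module.Projective A P] (h : GD A n K) :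
    GD A n (K × P) := by
  cases n with
  | zero =>
    have := h.1
    have := Module.finitePresentation_of_projective A P
    exact ⟨inferInstance, h.2.prod⟩
  | succ n =>
    obtain ⟨F, _, _, hF, hF', p, hp, h⟩ := h
    exact GD.succ_of_exact (LinearMap.inl_injective.comp (Submodule.injective_subtype _))
      (hp.prodMap Function.surjective_id) (exact_inl_snd_prodMap p) h

/-- The kernel of a composite of surjections is an extension of the kernels. -/
theorem exact_ker_comp {p : M →ₗ[A] E} (hp : Function.Surjective p) :
    ∃ (i : LinearMap.ker p →ₗ[A] LinearMap.ker (g ∘ₗ p))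
      (j : LinearMap.ker (g ∘ₗ p) →ₗ[A] LinearMap.ker g),
      Function.Injective i ∧ Function.Surjective j ∧ Function.Exact i j := by
  refine ⟨Submodule.inclusion (LinearMap.ker_le_ker_comp p g),
    p.restrict fun x hx => hx, Submodule.inclusion_injective _, ?_, ?_⟩
  · rintro ⟨y, hy⟩
    obtain ⟨x, rfl⟩ := hp y
    exact ⟨⟨x, hy⟩, rfl⟩
  · rintro ⟨x, hx⟩
    constructor
    · intro h
      exact ⟨⟨x, congrArg Subtype.val h⟩, rfl⟩
    · rintro ⟨⟨y, hy⟩, h⟩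
      have h : y = x := congrArg Subtype.val h
      subst h
      exact Subtype.ext hy

/-- Cancellation of a projective summand, needed for Schanuel. In positive degree, the kernel of `F
→ K × P → K` is an extension of `P` by `ker p`; it splits, so only a projective summand is added to
the syzygy. -/
theorem GD.of_prod {n : ℕ} [Module.Finite A P] [Module.Projective A P] (h : GD A n (K × P)) :
    GD A n K := by
  cases n with
  | zero =>
    have := h.1
    have h1 : Module.FinitePresentation A K :=
      Module.finitePresentation_of_projective_of_exact (LinearMap.inl A K P)
        (LinearMap.snd A K P) LinearMap.inl_injective LinearMap.snd_surjective .inl_snd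
    exact ⟨h1, GClass.left (f := LinearMap.inl A K P) (g := LinearMap.snd A K P)
      LinearMap.inl_injective LinearMap.snd_surjective .inl_snd h.2 .of_projective⟩
  | succ n =>
    obtain ⟨F, _, _, hF, hF', p, hp, h⟩ := h
    refine ⟨F, _, _, hF, hF', LinearMap.fst A K P ∘ₗ p,
      (LinearMap.fst_surjective (R := A) (M := K) (M₂ := P)).comp hp, ?_⟩
    obtain ⟨i, j, hi, hj, hij⟩ := exact_ker_comp (g := LinearMap.fst A K P) hp
    obtain ⟨e₂⟩ := nonempty_equiv_ker (f := LinearMap.inr A K P) (g := LinearMap.fst A K P)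
      LinearMap.inr_injective .inr_fst
    have : Module.Projective A (LinearMap.ker (LinearMap.fst A K P)) := .of_equiv e₂
    have : Module.Finite A (LinearMap.ker (LinearMap.fst A K P)) := .equiv e₂
    obtain ⟨e⟩ := nonempty_equiv_prod hi hj hij
    exact h.prod.of_equiv e.symm

/-- Schanuel's lemma: the pullback of the two surjections is both `ker p × E` and `ker p' × F`, so
any projective cover may be used to test `GD`. -/
theorem GD.ker {n : ℕ} (hM : GD A (n + 1) M) [Module.Finite A E] [Module.Projective A E]
    {p' : E →ₗ[A] M} (hp' : Function.Surjective p') : GD A n (LinearMap.ker p') := by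
  obtain ⟨F, _, _, hF, hF', p, hp, h⟩ := hM
  obtain ⟨Q, _, _, i, j, i', j', hi, hj, hij, hi', hj', hij'⟩ := exists_pullback hp hp'
  obtain ⟨e⟩ := nonempty_equiv_prod hi hj hij
  obtain ⟨e'⟩ := nonempty_equiv_prod hi' hj' hij'
  exact (h.prod.of_equiv (e.symm ≪≫ₗ e')).of_prod

/-- Horseshoe lemma: lift `q` through `g` to cover `E` by `F × H`; the kernels again form a short
exact sequence. -/
theorem GD.middle {n : ℕ} (hf : Function.Injective f) (hg : Function.Surjective g)
    (h : Function.Exact f g) (hK : GD A n K) (hG : GD A n G) : GD A n E := by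
  induction n generalizing K E G with
  | zero =>
    have := hK.1
    have := hG.1
    exact ⟨finitePresentation_of_exact hf hg h, hK.2.middle hf hg h hG.2⟩
  | succ n ih =>
    obtain ⟨F, _, _, hF, hF', p, hp, hK⟩ := hK
    obtain ⟨H, _, _, hH, hH', q, hq, hG⟩ := hG
    obtain ⟨q', hq'⟩ := Module.projective_lifting_property g q hg
    have hq' : ∀ y, g (q' y) = q y := fun y => LinearMap.congr_fun hq' y
    have hgf : ∀ y, g (f y) = 0 := fun y => h.apply_apply_eq_zero y
    let π : F × H →ₗ[A] E := (f ∘ₗ p).coprod q'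
    have hπ : ∀ z, π z = f (p z.1) + q' z.2 := fun z => rfl
    refine ⟨F × H, _, _, inferInstance, inferInstance, π, ?_, ?_⟩
    · intro e
      obtain ⟨y, hy⟩ := hq (g e)
      have : g (e - q' y) = 0 := by rw [map_sub, hq', hy, sub_self]
      obtain ⟨k, hk⟩ := (h _).1 this
      obtain ⟨x, rfl⟩ := hp k
      exact ⟨(x, y), by rw [hπ, hk]; abel⟩
    · refine ih (f := LinearMap.codRestrict (LinearMap.ker π)
          (LinearMap.inl A F H ∘ₗ (LinearMap.ker p).subtype) fun x => ?_)
        (g := (LinearMap.snd A F H).restrict (p := LinearMap.ker π) (q := LinearMap.ker q)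
          fun z hz => ?_) ?_ ?_ ?_ hK hG
      · rw [LinearMap.mem_ker, hπ]; simp
      · rw [LinearMap.mem_ker, hπ] at hz
        have := congrArg g hz
        simpa [hgf, hq'] using this
      · intro x y hxy
        exact Subtype.ext (congrArg (fun z : LinearMap.ker π => (z : F × H).1) hxy)
      · rintro ⟨y, hy⟩
        have : g (q' y) = 0 := by rw [hq']; exact hy
        obtain ⟨k, hk⟩ := (h _).1 this
        obtain ⟨x, rfl⟩ := hp k
        refine ⟨⟨(-x, y), ?_⟩, rfl⟩
        rw [LinearMap.mem_ker, hπ]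
        simp [hk]
      · rintro ⟨⟨x, y⟩, hz⟩
        rw [LinearMap.mem_ker, hπ] at hz
        constructor
        · intro h0
          have h0 : y = 0 := congrArg Subtype.val h0
          subst h0
          refine ⟨⟨x, hf ?_⟩, rfl⟩
          simpa using hz
        · rintro ⟨w, hw⟩
          have := congrArg (fun z : LinearMap.ker π => (z : F × H).2) hw
          exact Subtype.ext this.symm

end GD

/-! ### Coherent rings and finitely presented modules. -/

section Coherent

variable {A : Type u} [CommRing A]

/-- A property of modules that is closed under extensions and holds for finitely generated
ideals holds for finitely generated submodules of free modules over a coherent ring. -/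
theorem IsCoherent.pi_induction (hA : IsCoherent A)
    (P : ∀ (M : Type u) [AddCommGroup M] [Module A M], Prop)
    (hiso : ∀ (M N : Type u) [AddCommGroup M] [Module A M] [AddCommGroup N] [Module A N],
      (M ≃ₗ[A] N) → P M → P N)
    (hext : ∀ (K E G : Type u) [AddCommGroup K] [Module A K] [AddCommGroup E] [Module A E]
      [AddCommGroup G] [Module A G] (f : K →ₗ[A] E) (g : E →ₗ[A] G), Function.Injective f →
      Function.Surjective g → Function.Exact f g → P K → P G → P E)
    (hI : ∀ I : Ideal A, I.FG → P I) (n : ℕ) (N : Submodule A (Fin n → A)) (hN : N.FG) :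
    P N := by
  induction n with
  | zero =>
    refine hiso _ _ ?_ (hI ⊥ Submodule.fg_bot)
    exact { toFun := 0, invFun := 0, map_add' := fun _ _ => by simp, map_smul' := fun _ _ => by simp,
            left_inv := fun x => Subsingleton.elim _ _, right_inv := fun x => Subsingleton.elim _ _ }
  | succ n ih =>
    have := Module.Finite.iff_fg.2 hN
    let φ : N →ₗ[A] A := LinearMap.proj 0 ∘ₗ N.subtype
    have hfg : (LinearMap.range φ).FG := Module.Finite.iff_fg.1 inferInstance
    have := hA _ hfg
    -- Coherence makes the ideal of first coordinates finitely presented, so the kernel is finitely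
    -- generated and, being inside `A^n`, falls under the induction hypothesis.
    have hker : (LinearMap.ker φ.rangeRestrict).FG :=
      Module.FinitePresentation.fg_ker _ φ.surjective_rangeRestrict
    rw [LinearMap.ker_rangeRestrict] at hker
    let t : LinearMap.ker φ →ₗ[A] (Fin n → A) :=
      LinearMap.funLeft A A Fin.succ ∘ₗ N.subtype ∘ₗ (LinearMap.ker φ).subtype
    have ht : Function.Injective t := by
      rintro ⟨⟨x, hx⟩, hx0⟩ ⟨⟨y, hy⟩, hy0⟩ hxy
      have hx0 : x 0 = 0 := hx0
      have hy0 : y 0 = 0 := hy0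
      refine Subtype.ext (Subtype.ext (funext fun i => ?_))
      refine Fin.cases ?_ (fun i => ?_) i
      · simp [hx0, hy0]
      · exact congrFun hxy i
    have := Module.Finite.iff_fg.2 hker
    have h1 : P (LinearMap.range t) := ih _ (Module.Finite.iff_fg.1 inferInstance)
    have h2 : P (LinearMap.ker φ) := hiso _ _ (LinearEquiv.ofInjective t ht).symm h1
    refine hext _ _ _ (LinearMap.ker φ).subtype φ.rangeRestrict (Submodule.injective_subtype _)
      φ.surjective_rangeRestrict ?_ h2 (hI _ hfg)
    intro x
    simp [Subtype.ext_iff]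

theorem IsCoherent.finitePresentation_pi (hA : IsCoherent A) (n : ℕ)
    (N : Submodule A (Fin n → A)) (hN : N.FG) : Module.FinitePresentation A N :=
  hA.pi_induction (fun M _ _ => Module.FinitePresentation A M)
    (fun _ _ _ _ _ _ e _ => .of_equiv e)
    (fun _ _ _ _ _ _ _ _ _ _ _ hf hg h _ _ => finitePresentation_of_exact hf hg h) hA n N hN

variable {K E G M : Type u} [AddCommGroup K] [Module A K] [AddCommGroup E] [Module A E]
  [AddCommGroup G] [Module A G] [AddCommGroup M] [Module A M]
variable {f : K →ₗ[A] E} {g : E →ₗ[A] G}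

theorem IsCoherent.finitePresentation_submodule (hA : IsCoherent A)
    [Module.FinitePresentation A M] (N : Submodule A M) (hN : N.FG) :
    Module.FinitePresentation A N := by
  obtain ⟨n, π, hπ⟩ := Module.Finite.exists_fin' A M
  have hker : (LinearMap.ker π).FG := Module.FinitePresentation.fg_ker π hπ
  have hfg : (N.comap π).FG := by
    refine Submodule.fg_of_fg_map_of_fg_inf_ker π ?_ ?_
    · rwa [Submodule.map_comap_eq_of_surjective hπ]
    · rwa [inf_eq_right.2]
      exact LinearMap.ker_le_comap _
  have := hA.finitePresentation_pi n _ hfg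
  have := Module.Finite.iff_fg.2 hker
  refine finitePresentation_right_of_exact
    (f := Submodule.inclusion (LinearMap.ker_le_comap π (p := N)))
    (g := π.restrict (p := N.comap π) (q := N) fun _ h => h) ?_ ?_
  · rintro ⟨y, hy⟩
    obtain ⟨x, rfl⟩ := hπ y
    exact ⟨⟨x, hy⟩, rfl⟩
  · rintro ⟨x, hx⟩
    constructor
    · intro h
      exact ⟨⟨x, congrArg Subtype.val h⟩, rfl⟩
    · rintro ⟨⟨y, hy⟩, h⟩
      have h : y = x := congrArg Subtype.val h
      subst h
      exact Subtype.ext hy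

theorem IsCoherent.finitePresentation_ker (hA : IsCoherent A)
    [Module.FinitePresentation A E] [Module.FinitePresentation A G] (hg : Function.Surjective g) :
    Module.FinitePresentation A (LinearMap.ker g) :=
  hA.finitePresentation_submodule _ (Module.FinitePresentation.fg_ker g hg)

/-- Kernels of maps between finitely presented modules over a coherent ring are finitely
presented. -/
theorem IsCoherent.finitePresentation_ker' (hA : IsCoherent A)
    [Module.FinitePresentation A E] [Module.FinitePresentation A G] (g : E →ₗ[A] G) :
    Module.FinitePresentation A (LinearMap.ker g) := by
  have : Module.FinitePresentation A (LinearMap.range g) :=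
    hA.finitePresentation_submodule _ (Module.Finite.iff_fg.1 inferInstance)
  have := hA.finitePresentation_ker g.surjective_rangeRestrict
  exact .of_equiv (LinearEquiv.ofEq _ _ (LinearMap.ker_rangeRestrict g))

/-- Dualizing a finite presentation exhibits the dual as the kernel of a map of finite free modules.
-/
theorem IsCoherent.finitePresentation_dual (hA : IsCoherent A)
    [Module.FinitePresentation A M] : Module.FinitePresentation A (Module.Dual A M) := by
  obtain ⟨n, m, f, g, hf, hgf⟩ := Module.FinitePresentation.exists_fin' A M
  have h := exact_dualMap hf hgf
  have (k : ℕ) : Module.FinitePresentation A (Module.Dual A (Fin k → A)) :=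
    Module.finitePresentation_of_projective _ _
  have := hA.finitePresentation_ker' g.dualMap
  obtain ⟨e⟩ := nonempty_equiv_ker (LinearMap.dualMap_injective_of_surjective hf) h
  exact Module.FinitePresentation.of_equiv (M := LinearMap.ker g.dualMap) e.symm

/-- One more syzygy stays finitely presented by coherence, and stays in the G-class by
`GClass.left`. -/
theorem GD.succ (hA : IsCoherent A) {n : ℕ} (h : GD A n M) : GD A (n + 1) M := by
  induction n generalizing M with
  | zero =>
    have := h.1
    obtain ⟨n, π, hπ⟩ := Module.Finite.exists_fin' A M
    have := hA.finitePresentation_ker hπ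
    exact ⟨Fin n → A, _, _, inferInstance, inferInstance, π, hπ, this,
      GClass.left (Submodule.injective_subtype _) hπ (exact_ker_subtype π) .of_projective h.2⟩
  | succ n ih =>
    obtain ⟨F, _, _, hF, hF', p, hp, h⟩ := h
    exact ⟨F, _, _, hF, hF', p, hp, ih h⟩

theorem GD.mono (hA : IsCoherent A) {n m : ℕ} (hnm : n ≤ m) (h : GD A n M) : GD A m M := by
  induction hnm with
  | refl => exact h
  | step _ ih => exact ih.succ hA

end Coherent

/-! ### Comparing G-resolutions with projective syzygies. -/

section GResolution

variable {A : Type u} [CommRing A]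
variable {K E G M P : Type u} [AddCommGroup K] [Module A K] [AddCommGroup E] [Module A E]
  [AddCommGroup G] [Module A G] [AddCommGroup M] [Module A M] [AddCommGroup P] [Module A P]
variable {f : K →ₗ[A] E} {g : E →ₗ[A] G}

/-- Prolong a G-resolution of the kernel of a surjection. -/
def GResolution.cons (hf : Function.Injective f) (hg : Function.Surjective g)
    (h : Function.Exact f g) (hE : GClass A E) (R : GResolution A K) : GResolution A G where
  G
    | 0 => ModuleCat.of A E
    | n + 1 => R.G n
  d
    | 0 => f ∘ₗ R.aug
    | n + 1 => R.d n
  aug := g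
  mem_gClass
    | 0 => hE
    | n + 1 => R.mem_gClass n
  aug_surjective := hg
  exact_zero := by
    intro x
    rw [h x]
    constructor
    · rintro ⟨k, rfl⟩
      obtain ⟨y, rfl⟩ := R.aug_surjective k
      exact ⟨y, rfl⟩
    · rintro ⟨y, rfl⟩
      exact ⟨_, rfl⟩
  exact_succ
    | 0 => fun x => by
      rw [← R.exact_zero x]
      exact ⟨fun hx => hf (hx.trans (map_zero f).symm), fun hx => (congrArg f hx).trans (map_zero f)⟩
    | n + 1 => R.exact_succ n

/-- The zero resolution of the zero module. -/
def GResolution.zero [Subsingleton M] : GResolution A M where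
  G _ := ModuleCat.of A PUnit
  d _ := 0
  aug := 0
  mem_gClass _ := GClass.of_projective
  aug_surjective _ := ⟨0, Subsingleton.elim _ _⟩
  exact_zero _ := ⟨fun _ => ⟨0, Subsingleton.elim (α := PUnit) _ _⟩, fun _ => Subsingleton.elim _ _⟩
  exact_succ _ _ := ⟨fun _ => ⟨0, Subsingleton.elim (α := PUnit) _ _⟩,
    fun _ => Subsingleton.elim (α := PUnit) _ _⟩

theorem GD.exists_resolution {n : ℕ} (h : GD A n M) :
    ∃ R : GResolution A M, ∀ k, n < k → Subsingleton (R.G k) := by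
  induction n generalizing M with
  | zero =>
    refine ⟨GResolution.cons (f := (0 : PUnit.{u + 1} →ₗ[A] M)) (g := LinearMap.id)
      (fun _ _ _ => Subsingleton.elim (α := PUnit) _ _) Function.surjective_id ?_ h.2 GResolution.zero, fun k hk => ?_⟩
    · intro x
      exact ⟨fun hx => ⟨0, hx.symm⟩, fun ⟨_, hx⟩ => hx.symm⟩
    · obtain ⟨k, rfl⟩ := Nat.exists_eq_succ_of_ne_zero hk.ne'
      exact inferInstanceAs (Subsingleton PUnit)
  | succ n ih =>
    obtain ⟨F, _, _, hF, hF', p, hp, h⟩ := h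
    obtain ⟨R, hR⟩ := ih h
    refine ⟨R.cons (Submodule.injective_subtype _) hp (exact_ker_subtype p) .of_projective,
      fun k hk => ?_⟩
    obtain ⟨k, rfl⟩ := Nat.exists_eq_succ_of_ne_zero (Nat.ne_zero_of_lt hk)
    exact hR k (Nat.lt_of_succ_lt_succ hk)

theorem GD.gDim_lt_top {n : ℕ} (h : GD A n M) : gDim A M < ⊤ := by
  obtain ⟨R, hR⟩ := h.exists_resolution
  refine lt_of_le_of_lt ((iInf_le _ R).trans ?_) (ENat.natCast_lt_top n)
  refine iSup₂_le fun k hk => ?_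
  by_contra hlt
  have := hR k (by simpa using hlt)
  exact not_nontrivial _ hk

/-- `M` has a G-resolution of length at most `n`. -/
def HasGRes (A : Type u) [CommRing A] :
    ℕ → ∀ (M : Type u) [AddCommGroup M] [Module A M], Prop
  | 0, M, _, _ => GClass A M
  | n + 1, M, _, _ => ∃ (F : Type u) (_ : AddCommGroup F) (_ : Module A F) (p : F →ₗ[A] M),
      GClass A F ∧ Function.Surjective p ∧ HasGRes A n (LinearMap.ker p)

theorem HasGRes.of_equiv {n : ℕ} (e : E ≃ₗ[A] G) (h : HasGRes A n E) : HasGRes A n G := by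
  cases n with
  | zero => exact GClass.of_equiv e h
  | succ n =>
    obtain ⟨F, _, _, p, hF, hp, h⟩ := h
    refine ⟨F, _, _, e.toLinearMap ∘ₗ p, hF, e.surjective.comp hp, ?_⟩
    rw [LinearEquiv.ker_comp]
    exact h

theorem HasGRes.succ_of_exact {n : ℕ} (hE : GClass A E)
    (hf : Function.Injective f) (hg : Function.Surjective g) (h : Function.Exact f g)
    (hK : HasGRes A n K) : HasGRes A (n + 1) G := by
  obtain ⟨e⟩ := nonempty_equiv_ker hf h
  exact ⟨E, _, _, g, hE, hg, hK.of_equiv e⟩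

theorem HasGRes.finite {n : ℕ} (h : HasGRes A n M) : Module.Finite A M := by
  cases n with
  | zero => exact h.1
  | succ n =>
    obtain ⟨F, _, _, p, hF, hp, h⟩ := h
    have := hF.1
    exact .of_surjective p hp

theorem HasGRes.prod {n : ℕ} [Module.Finite A P] [Module.Projective A P] (h : HasGRes A n K) :
    HasGRes A n (K × P) := by
  cases n with
  | zero => exact GClass.prod h
  | succ n =>
    obtain ⟨F, _, _, p, hF, hp, h⟩ := h
    exact HasGRes.succ_of_exact hF.prod
      (LinearMap.inl_injective.comp (Submodule.injective_subtype _))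
      (hp.prodMap Function.surjective_id) (exact_inl_snd_prodMap p) h

theorem HasGRes.left {n : ℕ} [Module.Finite A K] (hf : Function.Injective f)
    (hg : Function.Surjective g) (h : Function.Exact f g) (hE : HasGRes A n E)
    (hG : GClass A G) : HasGRes A n K := by
  cases n with
  | zero => exact GClass.left hf hg h hE hG
  | succ n =>
    obtain ⟨F, _, _, p, hF, hp, hker⟩ := hE
    obtain ⟨i, j, hi, hj, hij⟩ := exact_ker_comp (g := g) hp
    obtain ⟨e⟩ := nonempty_equiv_ker hf h
    have := hker.finite
    have : Module.Finite A (LinearMap.ker g) := .equiv e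
    have : Module.Finite A (LinearMap.ker (g ∘ₗ p)) := .of_exact hij hj
    have hL : GClass A (LinearMap.ker (g ∘ₗ p)) :=
      GClass.left (Submodule.injective_subtype _) (hg.comp hp) (exact_ker_subtype _) hF hG
    exact (HasGRes.succ_of_exact hL hi hj hij hker).of_equiv e.symm

/-- Replaces the G-class cover `F` by a free one. The pullback `Q` of both covers is `ker p` plus a
free module, and `ker p'` is the kernel of `Q → F`, so `HasGRes.left` keeps the length. -/
theorem HasGRes.gd (hA : IsCoherent A) {n : ℕ} [Module.FinitePresentation A M]
    (h : HasGRes A n M) : GD A n M := by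
  induction n generalizing M with
  | zero => exact ⟨inferInstance, h⟩
  | succ n ih =>
    obtain ⟨F, _, _, p, hF, hp, h⟩ := h
    obtain ⟨k, p', hp'⟩ := Module.Finite.exists_fin' A M
    have := hA.finitePresentation_ker hp'
    obtain ⟨Q, _, _, i, j, i', j', hi, hj, hij, hi', hj', hij'⟩ := exists_pullback hp hp'
    obtain ⟨e⟩ := nonempty_equiv_prod hi hj hij
    have hQ : HasGRes A n Q := h.prod.of_equiv e.symm
    exact ⟨Fin k → A, _, _, inferInstance, inferInstance, p', hp', ih (hQ.left hi' hj' hij' hF)⟩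

theorem hasGRes_of_gDim_lt_top (h : gDim A M < ⊤) : ∃ n, HasGRes A n M := by
  obtain ⟨R, hR⟩ := iInf_lt_iff.1 h
  obtain ⟨n, hn⟩ := ENat.ne_top_iff_exists.1 hR.ne
  have hsub : ∀ k, n < k → Subsingleton (R.G k) := by
    intro k hk
    by_contra hns
    rw [not_subsingleton_iff_nontrivial] at hns
    have : (k : ℕ∞) ≤ R.length := le_iSup₂ (f := fun (n : ℕ) (_ : Nontrivial (R.G n)) => (n : ℕ∞)) k hns
    rw [← hn] at this
    exact absurd (by exact_mod_cast this) (not_le.2 hk)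
  have key : ∀ j i, i + j = n → HasGRes A j (LinearMap.range (R.d i)) := by
    intro j
    induction j with
    | zero =>
      intro i hi
      have := hsub (i + 1) (by omega)
      have : Subsingleton (LinearMap.range (R.d i)) := by
        refine ⟨?_⟩
        rintro ⟨_, x, rfl⟩ ⟨_, y, rfl⟩
        rw [Subsingleton.elim x y]
      exact GClass.of_projective
    | succ j ih =>
      intro i hi
      refine HasGRes.succ_of_exact (R.mem_gClass (i + 1))
        (Submodule.injective_subtype (LinearMap.range (R.d (i + 1))))
        (R.d i).surjective_rangeRestrict ?_ (ih (i + 1) (by omega))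
      intro x
      have := R.exact_succ i x
      simpa [Subtype.ext_iff] using this
  -- The bound is one more than the length: the zero module `range (R.d n)` counts as the last
  -- stage, which spares a case distinction at length zero.
  refine ⟨n + 1, HasGRes.succ_of_exact (R.mem_gClass 0)
    (Submodule.injective_subtype (LinearMap.range (R.d 0))) R.aug_surjective ?_
    (key n 0 (zero_add n))⟩
  intro x
  simpa using R.exact_zero x

end GResolution

/-! ### From ideals to all finitely presented modules. -/

section Gorenstein

variable {A : Type u} [CommRing A]

/-- Every finitely generated ideal has finite G-dimension. -/
def FinGDimIdeals (A : Type u) [CommRing A] : Prop :=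
  ∀ I : Ideal A, I.FG → gDim A I < ⊤

theorem FinGDimIdeals.exists_gd_ideal (hA : IsCoherent A) (h : FinGDimIdeals A) (I : Ideal A)
    (hI : I.FG) : ∃ n, GD A n I := by
  have := hA I hI
  obtain ⟨n, hn⟩ := hasGRes_of_gDim_lt_top (h I hI)
  exact ⟨n, hn.gd hA⟩

theorem FinGDimIdeals.exists_gd (hA : IsCoherent A) (h : FinGDimIdeals A)
    (M : Type u) [AddCommGroup M] [Module A M] [Module.FinitePresentation A M] :
    ∃ n, GD A n M := by
  obtain ⟨k, π, hπ⟩ := Module.Finite.exists_fin' A M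
  obtain ⟨n, hn⟩ := hA.pi_induction (fun M _ _ => ∃ n, GD A n M)
    (fun _ _ _ _ _ _ e ⟨n, hn⟩ => ⟨n, hn.of_equiv e⟩)
    (fun _ _ _ _ _ _ _ _ _ _ _ hf hg h ⟨n, hn⟩ ⟨m, hm⟩ => ⟨max n m,
      GD.middle hf hg h (hn.mono hA (le_max_left n m)) (hm.mono hA (le_max_right n m))⟩)
    (h.exists_gd_ideal hA) k (LinearMap.ker π) (Module.FinitePresentation.fg_ker π hπ)
  exact ⟨n + 1, Fin k → A, _, _, inferInstance, inferInstance, π, hπ, hn⟩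

end Gorenstein

/-! ### Localization of Ext vanishing, the G-class and G-dimension. -/

section Localization

variable {A B : Type u} [CommRing A] [CommRing B] [Algebra A B] (W : Submonoid A)
  [IsLocalization W B]

/-- The localization map of a finite free module. -/
abbrev freeLoc (A B : Type u) [CommRing A] [CommRing B] [Algebra A B] (s : ℕ) :
    (Fin s → A) →ₗ[A] (Fin s → B) :=
  .pi fun i => Algebra.linearMap A B ∘ₗ .proj i

variable {M M' : Type u} [AddCommGroup M] [Module A M] [AddCommGroup M'] [Module A M']
  [Module B M'] [IsScalarTower A B M'] (g : M →ₗ[A] M') [IsLocalizedModule W g]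

variable (B) in
/-- The localization of a linear form. -/
noncomputable abbrev dualLoc : Module.Dual A M →ₗ[A] Module.Dual B M' :=
  IsLocalizedModule.mapExtendScalars W g (Algebra.linearMap A B) B

theorem dualLoc_apply (φ : Module.Dual A M) (m : M) :
    dualLoc B W g φ (g m) = algebraMap A B (φ m) :=
  IsLocalizedModule.map_apply W g (Algebra.linearMap A B) φ m

include g in
theorem localization_presentation {s : ℕ} {p : (Fin s → A) →ₗ[A] M}
    (hp : Function.Surjective p) :
    ∃ p' : (Fin s → B) →ₗ[B] M', Function.Surjective p' ∧
      Function.Exact ((LinearMap.ker p).localized' B W (freeLoc A B s)).subtype p' := by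
  refine ⟨IsLocalizedModule.mapExtendScalars W (freeLoc A B s) g B p,
    IsLocalizedModule.map_surjective W (freeLoc A B s) g p hp, ?_⟩
  rw [LinearMap.exact_iff, Submodule.range_subtype,
    LinearMap.localized'_ker_eq_ker_localizedMap B W (freeLoc A B s) g p]
  rfl

theorem localization_extend {s : ℕ} (K : Submodule A (Fin s → A)) [Module.FinitePresentation A K]
    (h : ∀ φ : K →ₗ[A] A, ∃ ψ : (Fin s → A) →ₗ[A] A, ψ ∘ₗ K.subtype = φ)
    (φ' : K.localized' B W (freeLoc A B s) →ₗ[B] B) :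
    ∃ ψ : (Fin s → B) →ₗ[B] B, ψ ∘ₗ (K.localized' B W (freeLoc A B s)).subtype = φ' := by
  obtain ⟨⟨φ, a⟩, e⟩ := IsLocalizedModule.surj W
    (dualLoc B W (K.toLocalized' B W (freeLoc A B s))) φ'
  obtain ⟨ψ, rfl⟩ := h φ
  -- Since `K` is finitely presented, `a • φ'` is the localization of a form over `A`; extend that
  -- form, localize, and divide by `a`.
  refine ⟨IsLocalization.mk' B 1 a • dualLoc B W (freeLoc A B s) ψ, ?_⟩
  have h1 : dualLoc B W (freeLoc A B s) ψ ∘ₗ (K.localized' B W (freeLoc A B s)).subtype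
      = dualLoc B W (K.toLocalized' B W (freeLoc A B s)) (ψ ∘ₗ K.subtype) := by
    apply LinearMap.restrictScalars_injective A
    refine IsLocalizedModule.linearMap_ext W (K.toLocalized' B W (freeLoc A B s))
      (Algebra.linearMap A B) ?_
    ext x
    exact (dualLoc_apply W (freeLoc A B s) ψ x).trans
      (dualLoc_apply W (K.toLocalized' B W (freeLoc A B s)) (ψ ∘ₗ K.subtype) x).symm
  rw [LinearMap.smul_comp, h1, ← e]
  ext x
  simp only [LinearMap.smul_apply, smul_eq_mul, Submonoid.smul_def, Algebra.smul_def]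
  rw [← mul_assoc, IsLocalization.mk'_spec, map_one, one_mul]

include W in
theorem Perp.extVanish_localization (hA : IsCoherent A) (i : ℕ) {M M' : Type u} [AddCommGroup M]
    [Module A M] [AddCommGroup M'] [Module A M'] [Module B M'] [IsScalarTower A B M']
    (g : M →ₗ[A] M') [IsLocalizedModule W g] [Module.FinitePresentation A M]
    (h : Perp A M) : ExtVanish B M' (i + 1) := by
  induction i generalizing M M' with
  | zero =>
    obtain ⟨s, p, hp⟩ := Module.Finite.exists_fin' A M
    obtain ⟨p', hp', hex⟩ := localization_presentation (B := B) W g hp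
    have := hA.finitePresentation_ker hp
    refine ExtVanish.one (Submodule.injective_subtype _) hp' hex
      (Perp.of_projective (E := Fin s → B) 1 one_pos) ?_
    exact localization_extend W _
      ((h 1 one_pos).exists_extend (Submodule.injective_subtype _) hp (exact_ker_subtype p))
  | succ i ih =>
    obtain ⟨s, p, hp⟩ := Module.Finite.exists_fin' A M
    obtain ⟨p', hp', hex⟩ := localization_presentation (B := B) W g hp
    have := hA.finitePresentation_ker hp
    refine ExtVanish.succ (Submodule.injective_subtype _) hp' hex ?_
      (Perp.of_projective (E := Fin s → B) _ (Nat.succ_pos _))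
    exact ih ((LinearMap.ker p).toLocalized' B W (freeLoc A B s))
      (Perp.left (Submodule.injective_subtype _) hp (exact_ker_subtype p) .of_projective h)

include W g in
theorem Perp.localization (hA : IsCoherent A) [Module.FinitePresentation A M] (h : Perp A M) :
    Perp B M' := by
  intro i hi
  obtain ⟨i, rfl⟩ := Nat.exists_eq_succ_of_ne_zero hi.ne'
  exact h.extVanish_localization W hA i g

include W g in
theorem GClass.localization (hA : IsCoherent A) [Module.FinitePresentation A M]
    (h : GClass A M) : GClass B M' := by
  rw [gClass_iff] at h ⊢
  obtain ⟨h1, h2, h3, h4⟩ := h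
  have := hA.finitePresentation_dual (M := M)
  refine ⟨?_, h2.localization W g hA, h3.localization W (dualLoc B W g) hA, ?_⟩
  · exact Module.Finite.of_isLocalizedModule W g
  -- Duals of finitely presented modules localize, and the dual is again finitely presented, so
  -- biduality of `M'` is the localization of biduality of `M`.
  · have key : (Module.Dual.eval B M').restrictScalars A
        = IsLocalizedModule.map W g (dualLoc B W (dualLoc B W g)) (Module.Dual.eval A M) := by
      refine IsLocalizedModule.linearMap_ext W g (dualLoc B W (dualLoc B W g)) ?_
      ext m : 1
      simp only [LinearMap.comp_apply, IsLocalizedModule.map_apply]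
      apply LinearMap.restrictScalars_injective A
      refine IsLocalizedModule.linearMap_ext W (dualLoc B W g) (Algebra.linearMap A B) ?_
      ext φ
      exact (dualLoc_apply W g φ m).trans
        (dualLoc_apply W (dualLoc B W g) (Module.Dual.eval A M m) φ).symm
    have h5 : Function.Bijective
        (IsLocalizedModule.map W g (dualLoc B W (dualLoc B W g)) (Module.Dual.eval A M)) :=
      ⟨IsLocalizedModule.map_injective _ _ _ _ h4.1, IsLocalizedModule.map_surjective _ _ _ _ h4.2⟩
    rw [← key] at h5
    exact h5

include W in
theorem GD.localization (hA : IsCoherent A) {n : ℕ} {M M' : Type u} [AddCommGroup M]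
    [Module A M] [AddCommGroup M'] [Module A M'] [Module B M'] [IsScalarTower A B M']
    (g : M →ₗ[A] M') [IsLocalizedModule W g] (h : GD A n M) : GD B n M' := by
  induction n generalizing M M' with
  | zero =>
    have := h.1
    exact ⟨FinitePresentation.of_isBaseChange g ((isLocalizedModule_iff_isBaseChange W B g).1 inferInstance),
      h.2.localization W g hA⟩
  | succ n ih =>
    have := h.finitePresentation
    obtain ⟨s, p, hp⟩ := Module.Finite.exists_fin' A M
    obtain ⟨p', hp', hex⟩ := localization_presentation (B := B) W g hp
    exact GD.succ_of_exact (Submodule.injective_subtype _) hp' hex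
      (ih ((LinearMap.ker p).toLocalized' B W (freeLoc A B s)) (h.ker hp))

include W in
-- Clear the denominators of finitely many generators.
theorem exists_fg_localized (J : Ideal B) (hJ : J.FG) :
    ∃ I : Ideal A, I.FG ∧ Submodule.localized' B W (Algebra.linearMap A B) I = J := by
  classical
  obtain ⟨n, v, rfl⟩ := Submodule.fg_iff_exists_fin_generating_family.1 hJ
  obtain ⟨b, hb⟩ := IsLocalization.exist_integer_multiples_of_finset W (Finset.univ.image v)
  choose a ha using fun i : Fin n => hb (v i) (Finset.mem_image_of_mem v (Finset.mem_univ i))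
  refine ⟨Ideal.span (Set.range a), ⟨Finset.univ.image a, by simp⟩, ?_⟩
  rw [Ideal.localized'_eq_map, Ideal.map_span, ← Set.range_comp]
  apply le_antisymm
  · rw [Ideal.span_le]
    rintro _ ⟨i, rfl⟩
    simp only [Function.comp_apply, ha]
    exact (Ideal.span (Set.range v)).smul_of_tower_mem _ (Ideal.subset_span ⟨i, rfl⟩)
  · change Ideal.span (Set.range v) ≤ _
    rw [Ideal.span_le]
    rintro _ ⟨i, rfl⟩
    have h1 : algebraMap A B (a i) ∈ Ideal.span (Set.range (algebraMap A B ∘ a)) :=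
      Ideal.subset_span ⟨i, rfl⟩
    rw [ha, Algebra.smul_def] at h1
    exact (Ideal.unit_mul_mem_iff_mem _ (IsLocalization.map_units B b)).1 h1

include W in
theorem IsCoherent.localization (hA : IsCoherent A) : IsCoherent B := by
  intro J hJ
  obtain ⟨I, hI, rfl⟩ := exists_fg_localized W J hJ
  have := hA I hI
  exact FinitePresentation.of_isBaseChange (I.toLocalized' B W (Algebra.linearMap A B))
    ((isLocalizedModule_iff_isBaseChange W B _).1 inferInstance)

include W in
theorem FinGDimIdeals.localization (hA : IsCoherent A) (h : FinGDimIdeals A) :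
    FinGDimIdeals B := by
  intro J hJ
  obtain ⟨I, hI, rfl⟩ := exists_fg_localized W J hJ
  obtain ⟨n, hn⟩ := h.exists_gd_ideal hA I hI
  exact (hn.localization W hA (I.toLocalized' B W (Algebra.linearMap A B))).gDim_lt_top

/-- An isomorphism is a localization at the trivial submonoid. -/
theorem FinGDimIdeals.of_ringEquiv {A B : Type u} [CommRing A] [CommRing B] (hA : IsCoherent A)
    (e : A ≃+* B) (h : FinGDimIdeals A) : FinGDimIdeals B := by
  algebraize [e.toRingHom]
  have : IsLocalization (⊥ : Submonoid A) B :=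
    IsLocalization.of_le_isUnit_of_bijective (by
      rintro _ ⟨y, hy, rfl⟩
      rw [SetLike.mem_coe, Submonoid.mem_bot] at hy
      simp [hy]) e.bijective
  exact h.localization ⊥ hA

end Localization

/-! ### Duality modulo a regular element with Frobenius quotient. -/

section Reduction

/-- `S` is the quotient of the `A`-algebra `B` by the regular element `f`, and `S` is a
Frobenius algebra over `A` with Frobenius form `τ`. -/
structure FrobeniusQuotient (A B S : Type u) [CommRing A] [CommRing B] [CommRing S] [Algebra A B]
    [Algebra A S] (f : B) where
  q : B →ₐ[A] S
  surjective : Function.Surjective q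
  map_eq_zero : ∀ b, q b = 0 ↔ ∃ c, b = f * c
  regular : ∀ b, f * b = 0 → b = 0
  τ : S →ₗ[A] A
  perfect : Function.Bijective fun s : S => τ ∘ₗ LinearMap.mulLeft A s

/-- `f` is regular on the `B`-module `M`, and `r : M → N` identifies `N` with `M / fM`. -/
structure IsReduction {A B : Type u} [CommRing A] [CommRing B] [Algebra A B] (f : B)
    {M N : Type u} [AddCommGroup M] [Module A M] [Module B M] [AddCommGroup N] [Module A N]
    (r : M →ₗ[A] N) : Prop where
  regular : ∀ m : M, f • m = 0 → m = 0
  surjective : Function.Surjective r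
  map_eq_zero : ∀ m, r m = 0 ↔ ∃ m', m = f • m'

variable {A B S : Type u} [CommRing A] [CommRing B] [CommRing S] [Algebra A B] [Algebra A S]
  {f : B}

section Basic

variable {M N F F' : Type u} [AddCommGroup M] [Module A M] [Module B M]
  [AddCommGroup N] [Module A N]
  [AddCommGroup F] [Module A F] [Module B F] [IsScalarTower A B F]
  [AddCommGroup F'] [Module A F']

theorem IsReduction.exists_factor {r : M →ₗ[A] N} (hr : IsReduction f r) {Z : Type u}
    [AddCommGroup Z] [Module A Z] (h : M →ₗ[A] Z) (hh : ∀ m, h (f • m) = 0) :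
    ∃ h' : N →ₗ[A] Z, ∀ m, h' (r m) = h m := by
  have hle : LinearMap.ker r ≤ LinearMap.ker h := by
    intro m hm
    obtain ⟨m', rfl⟩ := (hr.map_eq_zero m).1 hm
    exact hh m'
  refine ⟨(LinearMap.ker r).liftQ h hle ∘ₗ
    (r.quotKerEquivOfSurjective hr.surjective).symm.toLinearMap, fun m => ?_⟩
  have : (r.quotKerEquivOfSurjective hr.surjective).symm (r m) = (LinearMap.ker r).mkQ m := by
    rw [LinearEquiv.symm_apply_eq]
    rfl
  simp [this]

theorem FrobeniusQuotient.isReduction (Q : FrobeniusQuotient A B S f) :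
    IsReduction f Q.q.toLinearMap :=
  ⟨Q.regular, Q.surjective, Q.map_eq_zero⟩

theorem FrobeniusQuotient.isReduction_pi (Q : FrobeniusQuotient A B S f) (s : ℕ) :
    IsReduction f (Q.q.toLinearMap.compLeft (Fin s)) where
  regular m hm := funext fun i => Q.regular _ (congrFun hm i)
  surjective y := by
    choose x hx using fun i => Q.surjective (y i)
    exact ⟨x, funext hx⟩
  map_eq_zero m := by
    constructor
    · intro h
      choose c hc using fun i => (Q.map_eq_zero (m i)).1 (congrFun h i)
      exact ⟨c, funext hc⟩
    · rintro ⟨c, rfl⟩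
      exact funext fun i => (Q.map_eq_zero _).2 ⟨c i, rfl⟩

/-- Because `f` is regular on `M`, reduction modulo `f` keeps `0 → ker p → F → M → 0` exact. This
carries free resolutions from `B` to `A`. -/
theorem IsReduction.exists_ker [IsScalarTower A B M] {r : M →ₗ[A] N} (hr : IsReduction f r)
    {rF : F →ₗ[A] F'} (hF : IsReduction f rF) {p : F →ₗ[B] M} (hp : Function.Surjective p) :
    ∃ p' : F' →ₗ[A] N, Function.Surjective p' ∧ (∀ x, p' (rF x) = r (p x)) ∧
      ∃ rK : LinearMap.ker p →ₗ[A] LinearMap.ker p',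
        IsReduction f rK ∧ ∀ k, (rK k : F') = rF k := by
  obtain ⟨p', hp'⟩ := hF.exists_factor (r ∘ₗ p.restrictScalars A) fun m => by
    simpa using (hr.map_eq_zero _).2 ⟨p m, rfl⟩
  have hp' : ∀ x, p' (rF x) = r (p x) := hp'
  refine ⟨p', ?_, hp', (rF ∘ₗ (LinearMap.ker p).subtype.restrictScalars A).codRestrict _ ?_, ?_,
    fun k => rfl⟩
  · intro y
    obtain ⟨m, rfl⟩ := hr.surjective y
    obtain ⟨x, rfl⟩ := hp m
    exact ⟨rF x, hp' x⟩
  · rintro ⟨k, hk⟩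
    have hk : p k = 0 := hk
    simp [hp', hk]
  · refine ⟨fun m hm => Subtype.ext (hF.regular _ (congrArg Subtype.val hm)), ?_, ?_⟩
    · rintro ⟨y, hy⟩
      obtain ⟨x, rfl⟩ := hF.surjective y
      have h0 : r (p x) = 0 := by rw [← hp']; exact hy
      obtain ⟨m, hm⟩ := (hr.map_eq_zero _).1 h0
      obtain ⟨x', rfl⟩ := hp m
      refine ⟨⟨x - f • x', ?_⟩, Subtype.ext ?_⟩
      · simp [hm]
      · have := (hF.map_eq_zero (f • x')).2 ⟨x', rfl⟩
        change rF (x - f • x') = rF x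
        rw [map_sub, this, sub_zero]
    · rintro ⟨k, hk⟩
      have hk' : p k = 0 := hk
      constructor
      · intro h
        obtain ⟨x, rfl⟩ := (hF.map_eq_zero k).1 (congrArg Subtype.val h)
        have : p x = 0 := hr.regular _ (by rw [← map_smul]; exact hk')
        exact ⟨⟨x, this⟩, rfl⟩
      · rintro ⟨⟨x, hx⟩, h⟩
        exact Subtype.ext ((hF.map_eq_zero k).2 ⟨x, congrArg Subtype.val h⟩)

end Basic

section Dual

variable {M N : Type u} [AddCommGroup M] [Module A M] [Module B M] [IsScalarTower A B M]
  [AddCommGroup N] [Module A N]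
  (Q : FrobeniusQuotient A B S f) {r : M →ₗ[A] N} (hr : IsReduction f r)

include Q hr

/-- The linear map on duals induced by a reduction. -/
theorem IsReduction.exists_dual : ∃ rD : Module.Dual B M →ₗ[A] Module.Dual A N,
    ∀ φ m, rD φ (r m) = Q.τ (Q.q (φ m)) := by
  choose d hd using fun φ : Module.Dual B M =>
    hr.exists_factor (Q.τ ∘ₗ Q.q.toLinearMap ∘ₗ φ.restrictScalars A) fun m => by
      have := (Q.map_eq_zero (f * φ m)).2 ⟨φ m, rfl⟩
      simp only [LinearMap.comp_apply, LinearMap.restrictScalars_apply, map_smul, smul_eq_mul,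
        AlgHom.toLinearMap_apply, this, map_zero]
  have hd : ∀ φ m, d φ (r m) = Q.τ (Q.q (φ m)) := hd
  refine ⟨{ toFun := d, map_add' := fun φ ψ => ?_, map_smul' := fun a φ => ?_ }, hd⟩
  · ext n
    obtain ⟨m, rfl⟩ := hr.surjective n
    simp [hd]
  · ext n
    obtain ⟨m, rfl⟩ := hr.surjective n
    simp [hd]

omit [Module A M] [IsScalarTower A B M] hr in
-- Applying the hypothesis to all `b • m` and using nondegeneracy of the Frobenius form gives `q (φ
-- m) = 0`, so `f` divides every value. Regularity makes the quotients unique, hence linear in `m`.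
theorem FrobeniusQuotient.exists_eq_smul (φ : Module.Dual B M)
    (h : ∀ m, Q.τ (Q.q (φ m)) = 0) : ∃ φ' : Module.Dual B M, φ = f • φ' := by
  have h1 : ∀ m, ∃ c, φ m = f * c := by
    intro m
    rw [← Q.map_eq_zero]
    apply Q.perfect.1
    ext t
    obtain ⟨b, rfl⟩ := Q.surjective t
    have := h (b • m)
    rw [map_smul, smul_eq_mul, map_mul, mul_comm] at this
    simpa using this
  choose c hc using h1
  have key : ∀ x y, f * x = f * y → x = y := fun x y hxy => by
    have := Q.regular (x - y) (by rw [mul_sub, hxy, sub_self])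
    exact sub_eq_zero.1 this
  refine ⟨{ toFun := c, map_add' := fun x y => key _ _ ?_, map_smul' := fun b x => key _ _ ?_ }, ?_⟩
  · rw [← hc, map_add, hc, hc, mul_add]
  · rw [← hc, map_smul, hc, smul_eq_mul, smul_eq_mul, RingHom.id_apply]
    ring
  · ext m
    exact hc m

/-- On a free cover the lift `φF` exists by perfectness of the Frobenius form. It need not kill `ker
p`, but its restriction there is `f • φ'`. Vanishing of `Ext^1` extends `φ'` to `φ''`, and `φF - f •
φ''` descends to `M` without changing the reduction. -/
theorem IsReduction.exists_lift_dual [Module.Finite B M] (hM : Perp B M) (ψ : Module.Dual A N) :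
    ∃ φ : Module.Dual B M, ∀ m, Q.τ (Q.q (φ m)) = ψ (r m) := by
  obtain ⟨s, p, hp⟩ := Module.Finite.exists_fin' B M
  have h1 : ∀ i : Fin s, ∃ b : B, ∀ c : B,
      Q.τ (Q.q (b * c)) = ψ (r (p (Pi.single i c))) := by
    intro i
    obtain ⟨χ, hχ⟩ := Q.isReduction.exists_factor
      (ψ ∘ₗ r ∘ₗ p.restrictScalars A ∘ₗ LinearMap.single A (fun _ : Fin s => B) i) fun c => by
        have : (Pi.single i (f • c) : Fin s → B) = f • Pi.single i c := by
          rw [Pi.single_smul]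
        simp only [LinearMap.comp_apply, LinearMap.coe_single, LinearMap.restrictScalars_apply,
          this, map_smul, (hr.map_eq_zero _).2 ⟨_, rfl⟩, map_zero]
    obtain ⟨t, ht⟩ := Q.perfect.2 χ
    obtain ⟨b, rfl⟩ := Q.surjective t
    refine ⟨b, fun c => ?_⟩
    have := LinearMap.congr_fun ht (Q.q c)
    simp only [LinearMap.comp_apply, LinearMap.mulLeft_apply] at this
    rw [map_mul, this]
    exact hχ c
  choose b hb using h1
  let φF : Module.Dual B (Fin s → B) := Fintype.linearCombination B b
  have hφF : ∀ v, Q.τ (Q.q (φF v)) = ψ (r (p v)) := by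
    intro v
    have hv : v = ∑ i, Pi.single i (v i) := (Finset.univ_sum_single v).symm
    conv_rhs => rw [hv]
    simp only [φF, Fintype.linearCombination_apply, map_sum, smul_eq_mul]
    exact Finset.sum_congr rfl fun i _ => by rw [mul_comm, hb]
  obtain ⟨φ', hφ'⟩ := Q.exists_eq_smul (φF ∘ₗ (LinearMap.ker p).subtype) fun k => by
    have hk : p k = 0 := k.2
    simp [hφF, hk]
  obtain ⟨φ'', hφ''⟩ := (hM 1 one_pos).exists_extend (Submodule.injective_subtype _) hp
    (exact_ker_subtype p) φ'
  have hker : LinearMap.ker p ≤ LinearMap.ker (φF - f • φ'') := by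
    intro k hk
    have h2 := LinearMap.congr_fun hφ' ⟨k, hk⟩
    have h3 := LinearMap.congr_fun hφ'' ⟨k, hk⟩
    simp only [LinearMap.comp_apply, Submodule.subtype_apply, LinearMap.smul_apply] at h2 h3
    simp [h2, h3]
  refine ⟨(LinearMap.ker p).liftQ _ hker ∘ₗ (p.quotKerEquivOfSurjective hp).symm.toLinearMap,
    fun m => ?_⟩
  obtain ⟨v, rfl⟩ := hp m
  have : (p.quotKerEquivOfSurjective hp).symm (p v) = (LinearMap.ker p).mkQ v := by
    rw [LinearEquiv.symm_apply_eq]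
    rfl
  have h4 : Q.q (f * φ'' v) = 0 := (Q.map_eq_zero _).2 ⟨_, rfl⟩
  simp [this, h4, hφF]

theorem IsReduction.dual [Module.Finite B M] (hM : Perp B M) {rD : Module.Dual B M →ₗ[A] Module.Dual A N}
    (hD : ∀ φ m, rD φ (r m) = Q.τ (Q.q (φ m))) : IsReduction f rD where
  regular φ hφ := LinearMap.ext fun m => Q.regular _ (LinearMap.congr_fun hφ m)
  surjective ψ := by
    obtain ⟨φ, hφ⟩ := hr.exists_lift_dual Q hM ψ
    refine ⟨φ, LinearMap.ext fun n => ?_⟩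
    obtain ⟨m, rfl⟩ := hr.surjective n
    rw [hD, hφ]
  map_eq_zero φ := by
    constructor
    · intro h
      refine Q.exists_eq_smul φ fun m => ?_
      rw [← hD, h, LinearMap.zero_apply]
    · rintro ⟨φ', rfl⟩
      ext n
      obtain ⟨m, rfl⟩ := hr.surjective n
      rw [hD]
      have : Q.q (f * φ' m) = 0 := (Q.map_eq_zero _).2 ⟨_, rfl⟩
      simp [this]

end Dual

end Reduction

/-! ### Descent and lifting of the G-class modulo a regular element. -/

section ReductionGD

variable {A B S : Type u} [CommRing A] [CommRing B] [CommRing S] [Algebra A B] [Algebra A S]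
  [Module.Finite A S] [Module.Free A S] {f : B}
variable {M N : Type u} [AddCommGroup M] [Module A M] [Module B M] [IsScalarTower A B M]
  [AddCommGroup N] [Module A N]

omit [Module.Free A S] in
theorem FrobeniusQuotient.finite_reduction (Q : FrobeniusQuotient A B S f) {r : M →ₗ[A] N}
    (hr : IsReduction f r) [Module.Finite B M] : Module.Finite A N := by
  obtain ⟨s, p, hp⟩ := Module.Finite.exists_fin' B M
  obtain ⟨p', hp', -⟩ := hr.exists_ker (Q.isReduction_pi s) hp
  exact .of_surjective p' hp'

theorem FrobeniusQuotient.finitePresentation_reduction (Q : FrobeniusQuotient A B S f)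
    {r : M →ₗ[A] N} (hr : IsReduction f r) [Module.FinitePresentation B M] :
    Module.FinitePresentation A N := by
  obtain ⟨s, p, hp⟩ := Module.Finite.exists_fin' B M
  obtain ⟨p', hp', -, rK, hK, -⟩ := hr.exists_ker (Q.isReduction_pi s) hp
  have : Module.Finite B (LinearMap.ker p) :=
    Module.Finite.iff_fg.2 (Module.FinitePresentation.fg_ker p hp)
  have := Q.finite_reduction hK
  have := Module.finitePresentation_of_projective A (Fin s → S)
  exact finitePresentation_right_of_exact hp' (exact_ker_subtype p')

omit [Module.Finite A S] in
-- In degree one, a form on `ker p'` lifts to `ker p`, extends to the free cover over `B`, and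
-- reduces again. Higher degrees shift to syzygies.
theorem Perp.extVanish_reduction (hB : IsCoherent B) (Q : FrobeniusQuotient A B S f) (i : ℕ)
    {M N : Type u} [AddCommGroup M] [Module A M] [Module B M] [IsScalarTower A B M]
    [AddCommGroup N] [Module A N] {r : M →ₗ[A] N}
    (hr : IsReduction f r) [Module.FinitePresentation B M] (hM : Perp B M) :
    ExtVanish A N (i + 1) := by
  induction i generalizing M N with
  | zero =>
    obtain ⟨s, p, hp⟩ := Module.Finite.exists_fin' B M
    obtain ⟨p', hp', -, rK, hK, hrK⟩ := hr.exists_ker (Q.isReduction_pi s) hp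
    have := hB.finitePresentation_ker hp
    have hPK : Perp B (LinearMap.ker p) :=
      Perp.left (Submodule.injective_subtype _) hp (exact_ker_subtype p) .of_projective hM
    refine ExtVanish.one (Submodule.injective_subtype _) hp' (exact_ker_subtype p')
      (Perp.of_projective (E := Fin s → S) 1 one_pos) fun χ => ?_
    obtain ⟨φ, hφ⟩ := hK.exists_lift_dual Q hPK χ
    obtain ⟨ψ, rfl⟩ := (hM 1 one_pos).exists_extend (Submodule.injective_subtype _) hp
      (exact_ker_subtype p) φ
    obtain ⟨rD, hrD⟩ := (Q.isReduction_pi s).exists_dual Q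
    refine ⟨rD ψ, LinearMap.ext fun y => ?_⟩
    obtain ⟨k, rfl⟩ := hK.surjective y
    rw [← hφ, LinearMap.comp_apply, Submodule.subtype_apply, hrK, hrD]
    rfl
  | succ i ih =>
    obtain ⟨s, p, hp⟩ := Module.Finite.exists_fin' B M
    obtain ⟨p', hp', -, rK, hK, hrK⟩ := hr.exists_ker (Q.isReduction_pi s) hp
    have := hB.finitePresentation_ker hp
    exact ExtVanish.succ (Submodule.injective_subtype _) hp' (exact_ker_subtype p')
      (ih hK (Perp.left (Submodule.injective_subtype _) hp (exact_ker_subtype p)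
        .of_projective hM)) (Perp.of_projective (E := Fin s → S) _ (Nat.succ_pos _))

omit [Module.Finite A S] in
theorem Perp.reduction (hB : IsCoherent B) (Q : FrobeniusQuotient A B S f) {r : M →ₗ[A] N}
    (hr : IsReduction f r) [Module.FinitePresentation B M] (hM : Perp B M) : Perp A N := by
  intro i hi
  obtain ⟨i, rfl⟩ := Nat.exists_eq_succ_of_ne_zero hi.ne'
  exact hM.extVanish_reduction hB Q i hr

/-- Nakayama's lemma, in the form used for every lifting below. -/
theorem submodule_eq_top_of_forall_exists (hf : f ∈ (⊥ : Ideal B).jacobson) {X : Type u}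
    [AddCommGroup X] [Module B X] [Module.Finite B X] (L : Submodule B X)
    (h : ∀ x, ∃ l ∈ L, ∃ y, x = l + f • y) : L = ⊤ := by
  rw [eq_top_iff]
  refine Submodule.le_of_le_smul_of_le_jacobson_bot (I := Ideal.span {f})
    Module.Finite.fg_top ?_ ?_
  · rwa [Ideal.span_singleton_le_iff_mem]
  · intro x _
    obtain ⟨l, hl, y, rfl⟩ := h x
    exact Submodule.add_mem_sup hl
      (Submodule.smul_mem_smul (Ideal.mem_span_singleton_self f) Submodule.mem_top)

omit [Module.Finite A S] in
-- In degree one, restriction of forms to `ker p` is onto modulo `f`; the dual of `ker p` is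
-- finitely generated by coherence, so Nakayama applies.
theorem Perp.extVanish_of_reduction (hB : IsCoherent B) (hf : f ∈ (⊥ : Ideal B).jacobson)
    (Q : FrobeniusQuotient A B S f) (i : ℕ)
    {M N : Type u} [AddCommGroup M] [Module A M] [Module B M] [IsScalarTower A B M]
    [AddCommGroup N] [Module A N] {r : M →ₗ[A] N}
    (hr : IsReduction f r) [Module.FinitePresentation B M] (hN : Perp A N) :
    ExtVanish B M (i + 1) := by
  induction i generalizing M N with
  | zero =>
    obtain ⟨s, p, hp⟩ := Module.Finite.exists_fin' B M
    obtain ⟨p', hp', -, rK, hK, hrK⟩ := hr.exists_ker (Q.isReduction_pi s) hp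
    have := hB.finitePresentation_ker hp
    have := hB.finitePresentation_dual (M := LinearMap.ker p)
    refine ExtVanish.one (Submodule.injective_subtype _) hp (exact_ker_subtype p)
      (Perp.of_projective (E := Fin s → B) 1 one_pos) fun φ => ?_
    have htop : LinearMap.range (LinearMap.ker p).subtype.dualMap = ⊤ := by
      refine submodule_eq_top_of_forall_exists hf _ fun φ => ?_
      obtain ⟨rD, hrD⟩ := hK.exists_dual Q
      obtain ⟨χ, hχ⟩ := (hN 1 one_pos).exists_extend (Submodule.injective_subtype _) hp'
        (exact_ker_subtype p') (rD φ)
      obtain ⟨ψ, hψ⟩ := (Q.isReduction_pi s).exists_lift_dual Q .of_projective χ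
      obtain ⟨φ', hφ'⟩ := Q.exists_eq_smul (φ - (LinearMap.ker p).subtype.dualMap ψ) fun k => by
        have h1 : Q.τ (Q.q (ψ k)) = Q.τ (Q.q (φ k)) := by
          rw [hψ, ← hrD, ← hχ, LinearMap.comp_apply, Submodule.subtype_apply, hrK]
        have h2 : (LinearMap.ker p).subtype.dualMap ψ k = ψ k := rfl
        rw [LinearMap.sub_apply, h2, map_sub, map_sub, h1, sub_self]
      exact ⟨_, ⟨ψ, rfl⟩, φ', by rw [← hφ']; abel⟩
    obtain ⟨ψ, hψ⟩ := LinearMap.range_eq_top.1 htop φ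
    exact ⟨ψ, hψ⟩
  | succ i ih =>
    obtain ⟨s, p, hp⟩ := Module.Finite.exists_fin' B M
    obtain ⟨p', hp', -, rK, hK, hrK⟩ := hr.exists_ker (Q.isReduction_pi s) hp
    have := hB.finitePresentation_ker hp
    exact ExtVanish.succ (Submodule.injective_subtype _) hp (exact_ker_subtype p)
      (ih hK (Perp.left (Submodule.injective_subtype _) hp' (exact_ker_subtype p')
        .of_projective hN)) (Perp.of_projective (E := Fin s → B) _ (Nat.succ_pos _))

omit [Module.Finite A S] in
theorem Perp.of_reduction (hB : IsCoherent B) (hf : f ∈ (⊥ : Ideal B).jacobson)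
    (Q : FrobeniusQuotient A B S f) {r : M →ₗ[A] N}
    (hr : IsReduction f r) [Module.FinitePresentation B M] (hN : Perp A N) : Perp B M := by
  intro i hi
  obtain ⟨i, rfl⟩ := Nat.exists_eq_succ_of_ne_zero hi.ne'
  exact hN.extVanish_of_reduction hB hf Q i hr

omit [Module.Finite A S] [Module.Free A S] [IsScalarTower A B M] in
theorem eval_reduction (Q : FrobeniusQuotient A B S f) {r : M →ₗ[A] N}
    {rD : Module.Dual B M →ₗ[A] Module.Dual A N}
    (hD : ∀ φ m, rD φ (r m) = Q.τ (Q.q (φ m))) (hrD : IsReduction f rD)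
    {rDD : Module.Dual B (Module.Dual B M) →ₗ[A] Module.Dual A (Module.Dual A N)}
    (hDD : ∀ ξ φ, rDD ξ (rD φ) = Q.τ (Q.q (ξ φ))) (m : M) :
    rDD (Module.Dual.eval B M m) = Module.Dual.eval A N (r m) := by
  ext ψ
  obtain ⟨φ, rfl⟩ := hrD.surjective ψ
  rw [hDD, Module.Dual.eval_apply, Module.Dual.eval_apply, hD]

theorem GClass.reduction (hB : IsCoherent B) (Q : FrobeniusQuotient A B S f) {r : M →ₗ[A] N}
    (hr : IsReduction f r) [Module.FinitePresentation B M] (h : GClass B M) : GClass A N := by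
  rw [gClass_iff] at h ⊢
  obtain ⟨-, h2, h3, h4⟩ := h
  have := hB.finitePresentation_dual (M := M)
  obtain ⟨rD, hD⟩ := hr.exists_dual Q
  have hrD := hr.dual Q h2 hD
  obtain ⟨rDD, hDD⟩ := hrD.exists_dual Q
  have hrDD := hrD.dual Q h3 hDD
  have key := eval_reduction Q hD hrD hDD
  refine ⟨Q.finite_reduction hr, h2.reduction hB Q hr, h3.reduction hB Q hrD, ?_, ?_⟩
  · rw [injective_iff_map_eq_zero]
    intro n hn
    obtain ⟨m, rfl⟩ := hr.surjective n
    rw [← key] at hn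
    obtain ⟨ξ, hξ⟩ := (hrDD.map_eq_zero _).1 hn
    obtain ⟨m', rfl⟩ := h4.2 ξ
    rw [← map_smul] at hξ
    exact (hr.map_eq_zero _).2 ⟨m', h4.1 hξ⟩
  · intro ζ
    obtain ⟨ξ, rfl⟩ := hrDD.surjective ζ
    obtain ⟨m, rfl⟩ := h4.2 ξ
    exact ⟨r m, (key m).symm⟩

omit [Module.Finite A S] in
theorem GClass.of_reduction (hB : IsCoherent B) (hf : f ∈ (⊥ : Ideal B).jacobson)
    (Q : FrobeniusQuotient A B S f) {r : M →ₗ[A] N}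
    (hr : IsReduction f r) [Module.FinitePresentation B M] (h : GClass A N) : GClass B M := by
  rw [gClass_iff] at h ⊢
  obtain ⟨-, h2, h3, h4⟩ := h
  have hM2 := h2.of_reduction hB hf Q hr
  have := hB.finitePresentation_dual (M := M)
  have := hB.finitePresentation_dual (M := Module.Dual B M)
  obtain ⟨rD, hD⟩ := hr.exists_dual Q
  have hrD := hr.dual Q hM2 hD
  have hM3 := h3.of_reduction hB hf Q hrD
  obtain ⟨rDD, hDD⟩ := hrD.exists_dual Q
  have hrDD := hrD.dual Q hM3 hDD
  have key := eval_reduction Q hD hrD hDD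
  have hsurj : Function.Surjective (Module.Dual.eval B M) := by
    rw [← LinearMap.range_eq_top]
    refine submodule_eq_top_of_forall_exists hf _ fun ξ => ?_
    obtain ⟨n, hn⟩ := h4.2 (rDD ξ)
    obtain ⟨m, rfl⟩ := hr.surjective n
    obtain ⟨ξ', hξ'⟩ := (hrDD.map_eq_zero (ξ - Module.Dual.eval B M m)).1 (by
      rw [map_sub, key, hn, sub_self])
    exact ⟨_, ⟨m, rfl⟩, ξ', by rw [← hξ']; abel⟩
  refine ⟨inferInstance, hM2, hM3, ?_, hsurj⟩
  rw [← LinearMap.ker_eq_bot]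
  have : Module.Finite B (LinearMap.ker (Module.Dual.eval B M)) :=
    Module.Finite.iff_fg.2 (Module.FinitePresentation.fg_ker _ hsurj)
  -- A kernel element is `f • m` because biduality of `N` is injective. As `f` is regular on the
  -- bidual, `m` is again in the kernel, so the kernel equals `f` times itself.
  have htop := submodule_eq_top_of_forall_exists hf
    (⊥ : Submodule B (LinearMap.ker (Module.Dual.eval B M))) fun ⟨k, hk⟩ => by
      have hk : Module.Dual.eval B M k = 0 := hk
      have h5 : r k = 0 := h4.1 (by rw [← key, hk, map_zero, map_zero])
      obtain ⟨m, rfl⟩ := (hr.map_eq_zero k).1 h5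
      rw [map_smul] at hk
      exact ⟨0, rfl, ⟨m, hrDD.regular _ hk⟩, by ext; simp⟩
  rw [eq_bot_iff]
  intro k hk
  have h6 : (⟨k, hk⟩ : LinearMap.ker (Module.Dual.eval B M)) ∈
      (⊥ : Submodule B (LinearMap.ker (Module.Dual.eval B M))) := htop ▸ Submodule.mem_top
  exact congrArg Subtype.val h6

theorem GD.reduction (hB : IsCoherent B) (Q : FrobeniusQuotient A B S f) {n : ℕ}
    {M N : Type u} [AddCommGroup M] [Module A M] [Module B M] [IsScalarTower A B M]
    [AddCommGroup N] [Module A N] {r : M →ₗ[A] N}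
    (hr : IsReduction f r) (h : GD B n M) : GD A n N := by
  have := h.finitePresentation
  induction n generalizing M N with
  | zero => exact ⟨Q.finitePresentation_reduction hr, h.2.reduction hB Q hr⟩
  | succ n ih =>
    obtain ⟨s, p, hp⟩ := Module.Finite.exists_fin' B M
    obtain ⟨p', hp', -, rK, hK, -⟩ := hr.exists_ker (Q.isReduction_pi s) hp
    exact GD.succ_of_exact (Submodule.injective_subtype _) hp' (exact_ker_subtype p')
      (ih hK (h.ker hp) (h.ker hp).finitePresentation)

theorem GD.of_reduction (hB : IsCoherent B) (hf : f ∈ (⊥ : Ideal B).jacobson)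
    (Q : FrobeniusQuotient A B S f) {n : ℕ}
    {M N : Type u} [AddCommGroup M] [Module A M] [Module B M] [IsScalarTower A B M]
    [AddCommGroup N] [Module A N] [Module.FinitePresentation B M] {r : M →ₗ[A] N}
    (hr : IsReduction f r) (h : GD A n N) : GD B n M := by
  induction n generalizing M N with
  | zero => exact ⟨inferInstance, h.2.of_reduction hB hf Q hr⟩
  | succ n ih =>
    obtain ⟨s, p, hp⟩ := Module.Finite.exists_fin' B M
    obtain ⟨p', hp', -, rK, hK, -⟩ := hr.exists_ker (Q.isReduction_pi s) hp
    have := hB.finitePresentation_ker hp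
    exact GD.succ_of_exact (Submodule.injective_subtype _) hp (exact_ker_subtype p)
      (ih hK (h.ker hp'))

/-- If `B / fB` is a Frobenius algebra over `A` with `f` regular and in the Jacobson radical,
then finiteness of G-dimensions lifts from `A` to `B`. -/
theorem FinGDimIdeals.of_frobeniusQuotient (hA : IsCoherent A) (hB : IsCoherent B)
    (hf : f ∈ (⊥ : Ideal B).jacobson) (Q : FrobeniusQuotient A B S f) (h : FinGDimIdeals A) :
    FinGDimIdeals B := by
  intro I hI
  have := hB I hI
  let P : Submodule B I := LinearMap.range (LinearMap.lsmul B I f)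
  have hr : IsReduction f (P.mkQ.restrictScalars A) := by
    refine ⟨fun m hm => Subtype.ext (Q.regular _ (congrArg Subtype.val hm)),
      Submodule.mkQ_surjective P, fun m => ?_⟩
    rw [LinearMap.restrictScalars_apply, Submodule.mkQ_apply, Submodule.Quotient.mk_eq_zero]
    exact ⟨fun ⟨b, hb⟩ => ⟨b, hb.symm⟩, fun ⟨b, hb⟩ => ⟨b, hb.symm⟩⟩
  have := Q.finitePresentation_reduction hr
  -- `I/fI` is only a finitely presented `A`-module, not an ideal, so the extension of
  -- `FinGDimIdeals` to all such modules is needed here.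
  obtain ⟨n, hn⟩ := h.exists_gd hA (I ⧸ P)
  exact (hn.of_reduction hB hf Q hr).gDim_lt_top

end ReductionGD
open Polynomial

/-! ### Frobenius quotients of localized polynomial rings. -/

section Construction

variable {A B S : Type u} [CommRing A] [CommRing B] [CommRing S] [Algebra A B] [Algebra A S]
  [Algebra A[X] B] [IsScalarTower A A[X] B]

/-- Localizing `A[X]` at a prime `n` does not change the quotient by `f` if the elements
outside `n` are units modulo `f`. -/
noncomputable def FrobeniusQuotient.ofPolynomial (n : Ideal A[X]) [n.IsPrime]
    [IsLocalization.AtPrime B n] (f : A[X]) (hreg : ∀ g, f * g = 0 → g = 0)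
    (π : A[X] →ₐ[A] S) (hπ : Function.Surjective π) (hker : ∀ g, π g = 0 ↔ f ∣ g)
    (hunit : ∀ g ∉ n, IsUnit (π g)) (τ : S →ₗ[A] A)
    (hτ : Function.Bijective fun s : S => τ ∘ₗ LinearMap.mulLeft A s) :
    FrobeniusQuotient A B S (algebraMap A[X] B f) where
  q := IsLocalization.liftAlgHom (M := n.primeCompl) (f := π) fun y => hunit y y.2
  surjective s := by
    obtain ⟨g, rfl⟩ := hπ s
    exact ⟨algebraMap A[X] B g, by simp⟩
  map_eq_zero b := by
    constructor
    · intro h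
      obtain ⟨g, w, rfl⟩ := IsLocalization.exists_mk'_eq n.primeCompl b
      have h1 : π g = 0 := by
        rw [IsLocalization.liftAlgHom_apply, IsLocalization.lift_mk'_spec] at h
        simpa using h
      obtain ⟨c, rfl⟩ := (hker g).1 h1
      exact ⟨IsLocalization.mk' B c w, (IsLocalization.mul_mk'_eq_mk'_of_mul f c w).symm⟩
    · rintro ⟨c, rfl⟩
      have : π f = 0 := (hker f).2 dvd_rfl
      rw [map_mul, IsLocalization.liftAlgHom_apply, IsLocalization.lift_eq]
      simp [this]
  regular b hb := by
    obtain ⟨g, w, rfl⟩ := IsLocalization.exists_mk'_eq n.primeCompl b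
    rw [IsLocalization.mul_mk'_eq_mk'_of_mul, IsLocalization.mk'_eq_zero_iff] at hb
    obtain ⟨c, hc⟩ := hb
    rw [IsLocalization.mk'_eq_zero_iff]
    exact ⟨c, hreg _ (by rw [← hc]; ring)⟩
  τ := τ
  perfect := hτ

/-- A monogenic algebra is a Frobenius algebra. -/
theorem exists_perfect_of_powerBasis (pb : PowerBasis A S) (hdim : 0 < pb.dim) :
    ∃ τ : S →ₗ[A] A, Function.Bijective fun s : S => τ ∘ₗ LinearMap.mulLeft A s := by
  let b := pb.basis
  have hlast : pb.dim - 1 < pb.dim := by omega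
  -- The Frobenius form is the coefficient of the highest power of the generator. Descending
  -- induction shows that all coordinate forms are multiples of it.
  let τ : S →ₗ[A] A := b.coord ⟨pb.dim - 1, hlast⟩
  let Λ : S →ₗ[A] Module.Dual A S := LinearMap.llcomp A S S A τ ∘ₗ LinearMap.mul A S
  have hΛ : ∀ s t, Λ s t = τ (s * t) := fun s t => rfl
  have hb : ∀ j : Fin pb.dim, b j = pb.gen ^ (j : ℕ) := fun j => pb.basis_eq_pow j
  have hτ : τ ∈ LinearMap.range Λ := ⟨1, by ext t; rw [hΛ, one_mul]⟩
  have hgen : ∀ φ ∈ LinearMap.range Λ, φ ∘ₗ LinearMap.mulLeft A pb.gen ∈ LinearMap.range Λ := by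
    rintro _ ⟨s, rfl⟩
    refine ⟨s * pb.gen, ?_⟩
    ext t
    rw [hΛ, LinearMap.comp_apply, LinearMap.mulLeft_apply, hΛ, mul_assoc]
  have hcoord : ∀ k (i : Fin pb.dim), (i : ℕ) + k = pb.dim - 1 →
      b.coord i ∈ LinearMap.range Λ := by
    intro k
    induction k with
    | zero =>
      intro i hi
      have : i = ⟨pb.dim - 1, hlast⟩ := Fin.ext (by simpa using hi)
      rw [this]
      exact hτ
    | succ k ih =>
      intro i hi
      let i' : Fin pb.dim := ⟨i + 1, by omega⟩
      have h1 := hgen _ (ih i' (by simp only [i']; omega))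
      set c := b.coord i' (pb.gen ^ pb.dim) with hc
      -- Multiplication by the generator shifts the basis except at its last element, where `pb.gen
      -- ^ pb.dim` appears; `c • τ` removes exactly that contribution.
      have h2 : b.coord i = b.coord i' ∘ₗ LinearMap.mulLeft A pb.gen - c • τ := by
        refine b.ext fun j => ?_
        rw [LinearMap.sub_apply, LinearMap.comp_apply, LinearMap.mulLeft_apply,
          LinearMap.smul_apply, smul_eq_mul]
        have hj : pb.gen * b j = pb.gen ^ ((j : ℕ) + 1) := by rw [hb, pow_succ']
        rw [hj]
        by_cases hjl : (j : ℕ) + 1 < pb.dim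
        · have h3 : pb.gen ^ ((j : ℕ) + 1) = b ⟨j + 1, hjl⟩ := (hb ⟨j + 1, hjl⟩).symm
          have h4 : τ (b j) = 0 := by
            simp only [τ, Module.Basis.coord_apply, Module.Basis.repr_self]
            rw [Finsupp.single_eq_of_ne]
            intro h
            have := congrArg Fin.val h
            simp only at this
            omega
          rw [h3, h4, mul_zero, sub_zero]
          simp only [Module.Basis.coord_apply, Module.Basis.repr_self, Finsupp.single_apply,
            Fin.ext_iff, i']
          simp
        · have h5 : (j : ℕ) + 1 = pb.dim := by omega
          have h6 : τ (b j) = 1 := by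
            have : j = ⟨pb.dim - 1, hlast⟩ := Fin.ext (by simp only; omega)
            simp only [τ, Module.Basis.coord_apply, Module.Basis.repr_self, this,
              Finsupp.single_eq_same]
          rw [h5, h6, mul_one, ← hc, sub_self]
          simp only [Module.Basis.coord_apply, Module.Basis.repr_self]
          rw [Finsupp.single_eq_of_ne]
          intro h
          have := congrArg Fin.val h
          omega
      rw [h2]
      exact Submodule.sub_mem _ h1 (Submodule.smul_mem _ _ hτ)
  have hsurj : Function.Surjective Λ := by
    intro ψ
    rw [← LinearMap.mem_range, ← b.sum_dual_apply_smul_coord ψ]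
    exact Submodule.sum_mem _ fun i _ => Submodule.smul_mem _ _ (hcoord (pb.dim - 1 - i) i (by omega))
  have hinj : Function.Injective Λ := by
    have : Module.Finite A S := pb.finite
    have h7 : Function.Injective (b.toDualEquiv.symm.toLinearMap ∘ₗ Λ) :=
      OrzechProperty.injective_of_surjective_endomorphism _
        (b.toDualEquiv.symm.surjective.comp hsurj)
    exact Function.Injective.of_comp h7
  exact ⟨τ, hinj, hsurj⟩

/-- If `n` were extended from `A`, then `X ∉ n`, so `X` is invertible modulo `n`; the constant term
of `y * X + i = 1` would then put `1` in `n ∩ A`. This is what allows a monic polynomial to be found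
in `n`. -/
theorem ne_map_of_isMaximal (n : Ideal A[X]) [hn : n.IsMaximal] : n ≠ (n.comap C).map C := by
  intro h
  have hX : (X : A[X]) ∉ n := by
    rw [h, Ideal.mem_map_C_iff]
    intro h1
    have := h1 1
    rw [coeff_X_one, Ideal.mem_comap, map_one] at this
    exact hn.ne_top ((Ideal.eq_top_iff_one _).2 this)
  obtain ⟨y, i, hi, hyi⟩ := hn.exists_inv hX
  have hi' := hi
  rw [h, Ideal.mem_map_C_iff] at hi'
  have h0 := hi' 0
  have h1 : i.coeff 0 = 1 := by
    have := congrArg (fun g => coeff g 0) hyi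
    simpa using this
  rw [h1, Ideal.mem_comap, map_one] at h0
  exact hn.ne_top ((Ideal.eq_top_iff_one _).2 h0)

/-- A maximal ideal `n` of `A[X]` over the closed point contains a monic polynomial such that
`n` is the only maximal ideal that contains it. -/
theorem exists_monic_isUnit [IsLocalRing A] (n : Ideal A[X]) [hn : n.IsMaximal]
    (hnA : n.comap C = IsLocalRing.maximalIdeal A) :
    ∃ f : A[X], f.Monic ∧ f ∈ n ∧ ∀ g ∉ n, IsUnit (AdjoinRoot.mk f g) := by
  obtain ⟨f, hf, hnf⟩ := exists_monic_span_sup_map_eq A n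
    (by rw [hnA]; infer_instance) (ne_map_of_isMaximal n)
  refine ⟨f, hf, ?_, ?_⟩
  · rw [hnf]
    exact Ideal.mem_sup_right (Ideal.mem_span_singleton_self f)
  · intro g hg
    by_contra hunit
    obtain ⟨M, hM, hgM⟩ := exists_max_ideal_of_mem_nonunits hunit
    have : Module.Finite A (AdjoinRoot f) := hf.finite_adjoinRoot
    have : Algebra.IsIntegral A (AdjoinRoot f) := inferInstance
    have h1 : (M.comap (algebraMap A (AdjoinRoot f))).IsMaximal :=
      Ideal.isMaximal_comap_of_isIntegral_of_isMaximal M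
    have h2 := IsLocalRing.eq_maximalIdeal h1
    -- By integrality `M` lies over the maximal ideal of `A`, so its preimage contains both parts
    -- generating `n`.
    have h3 : n ≤ M.comap (AdjoinRoot.mk f) := by
      rw [hnf, hnA, sup_le_iff, Ideal.map_le_iff_le_comap, Ideal.span_singleton_le_iff_mem,
        ← h2]
      exact ⟨le_rfl, by rw [Ideal.mem_comap, AdjoinRoot.mk_self]; exact M.zero_mem⟩
    have h4 : M.comap (AdjoinRoot.mk f) ≠ ⊤ := Ideal.comap_ne_top _ hM.ne_top
    rw [hn.eq_of_le h4 h3] at hg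
    exact hg hgM

theorem mem_jacobson_of_mem (n : Ideal A[X]) [n.IsPrime] {f : A[X]} (hf : f ∈ n) :
    algebraMap A[X] (Localization.AtPrime n) f ∈
      (⊥ : Ideal (Localization.AtPrime n)).jacobson := by
  rw [IsLocalRing.jacobson_eq_maximalIdeal ⊥ bot_ne_top]
  exact (IsLocalization.AtPrime.to_map_mem_maximal_iff _ n f).2 hf

theorem FinGDimIdeals.localization_polynomial [IsLocalRing A] (hA : IsCoherent A) (n : Ideal A[X])
    [n.IsMaximal] (hnA : n.comap C = IsLocalRing.maximalIdeal A)
    (hB : IsCoherent (Localization.AtPrime n)) (h : FinGDimIdeals A) :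
    FinGDimIdeals (Localization.AtPrime n) := by
  obtain ⟨f, hf, hfn, hunit⟩ := exists_monic_isUnit n hnA
  have : Module.Finite A (AdjoinRoot f) := hf.finite_adjoinRoot
  have : Module.Free A (AdjoinRoot f) := hf.free_adjoinRoot
  have hdim : 0 < (AdjoinRoot.powerBasis' hf).dim := by
    rw [AdjoinRoot.powerBasis'_dim, Nat.pos_iff_ne_zero]
    intro h0
    rw [hf.natDegree_eq_zero] at h0
    subst h0
    exact ‹n.IsMaximal›.ne_top ((Ideal.eq_top_iff_one _).2 hfn)
  obtain ⟨τ, hτ⟩ := exists_perfect_of_powerBasis (AdjoinRoot.powerBasis' hf) hdim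
  have Q : FrobeniusQuotient A (Localization.AtPrime n) (AdjoinRoot f)
      (algebraMap A[X] (Localization.AtPrime n) f) :=
    .ofPolynomial n f (fun g hg => hf.isRegular.left.eq_iff.1 (hg.trans (mul_zero f).symm))
      (AdjoinRoot.mkₐ f) AdjoinRoot.mk_surjective (fun g => AdjoinRoot.mk_eq_zero) hunit τ hτ
  exact h.of_frobeniusQuotient hA hB (mem_jacobson_of_mem n hfn) Q

/-- The prime ideal of `A[X]` generated by the maximal ideal of `A` and `X`. -/
noncomputable abbrev originIdeal (A : Type u) [CommRing A] [IsLocalRing A] : Ideal A[X] :=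
  (IsLocalRing.maximalIdeal A).comap constantCoeff

theorem FinGDimIdeals.of_localization_polynomial [IsLocalRing A]
    (hB : IsCoherent (Localization.AtPrime (originIdeal A)))
    (h : FinGDimIdeals (Localization.AtPrime (originIdeal A))) : FinGDimIdeals A := by
  set n := originIdeal A
  set B := Localization.AtPrime n
  have hπ : ∀ g : A[X], aeval (0 : A) g = g.coeff 0 := fun g => by
    rw [coe_aeval_eq_eval, coeff_zero_eq_eval_zero]
  have hregX : ∀ g : A[X], X * g = 0 → g = 0 := fun g hg => by
    ext i
    have := congrArg (fun p => coeff p (i + 1)) hg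
    simpa using this
  let Q : FrobeniusQuotient A B A (algebraMap A[X] B X) :=
    .ofPolynomial n X hregX (aeval (0 : A)) (fun a => ⟨C a, by simp⟩)
      (fun g => by rw [hπ, X_dvd_iff])
      (fun g hg => by
        rw [hπ]
        by_contra hu
        exact hg ((IsLocalRing.mem_maximalIdeal _).2 hu)) LinearMap.id
      ⟨fun a b hab => by simpa using LinearMap.congr_fun hab 1,
        fun φ => ⟨φ 1, by ext; simp⟩⟩
  intro J hJ
  let M : Ideal B := J.map (algebraMap A B)
  have hM : M.FG := hJ.map _
  have hmem : ∀ b ∈ M, Q.q b ∈ J := by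
    intro b hb
    have : M ≤ J.comap Q.q.toRingHom := by
      rw [Ideal.map_le_iff_le_comap]
      intro a ha
      rw [Ideal.mem_comap, Ideal.mem_comap]
      change Q.q (algebraMap A B a) ∈ J
      rwa [AlgHom.commutes]
    exact this hb
  let r : M →ₗ[A] J := (Q.q.toLinearMap ∘ₗ M.subtype.restrictScalars A).codRestrict
    (J : Submodule A A) fun b => hmem b b.2
  have hr : IsReduction (A := A) (M := M) (N := J) (algebraMap A[X] B X) r := by
    refine ⟨fun m hm => Subtype.ext (Q.regular _ (congrArg Subtype.val hm)), ?_, ?_⟩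
    · rintro ⟨a, ha⟩
      exact ⟨⟨algebraMap A B a, Ideal.mem_map_of_mem _ ha⟩, Subtype.ext (Q.q.commutes a)⟩
    · rintro ⟨b, hb⟩
      constructor
      · intro h0
        obtain ⟨c, rfl⟩ := (Q.map_eq_zero b).1 (congrArg Subtype.val h0)
        -- Up to a denominator, membership in `M` means that all coefficients lie in `J`, and
        -- multiplication by `X` merely shifts coefficients. Hence `M/XM` is exactly `J`.
        have hc : c ∈ M := by
          have hMmap : M = (J.map C).map (algebraMap A[X] B) := by
            rw [Ideal.map_map]
            rfl
          obtain ⟨g, w, rfl⟩ := IsLocalization.exists_mk'_eq n.primeCompl c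
          rw [IsLocalization.mul_mk'_eq_mk'_of_mul, hMmap,
            IsLocalization.mk'_mem_map_algebraMap_iff] at hb
          rw [hMmap, IsLocalization.mk'_mem_map_algebraMap_iff]
          obtain ⟨v, hv, hvg⟩ := hb
          refine ⟨v, hv, ?_⟩
          rw [Ideal.mem_map_C_iff] at hvg ⊢
          intro i
          have := hvg (i + 1)
          rwa [mul_left_comm, coeff_X_mul] at this
        exact ⟨⟨c, hc⟩, rfl⟩
      · rintro ⟨⟨c, hc⟩, h1⟩
        exact Subtype.ext ((Q.map_eq_zero b).2 ⟨c, congrArg Subtype.val h1⟩)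
  obtain ⟨k, hk⟩ := h.exists_gd_ideal hB M hM
  exact (hk.reduction hB Q hr).gDim_lt_top

end Construction

/-! ### Coherence of the base ring, and the two implications. -/

section Main

/-- Relations among constants over `R[X]` are finitely generated; their constant terms are precisely
the relations over `R`. -/
theorem IsCoherent.of_polynomial {R : Type u} [CommRing R] (h : IsCoherent R[X]) :
    IsCoherent R := by
  intro I hI
  have := Module.Finite.iff_fg.2 hI
  obtain ⟨n, p, hp⟩ := Module.Finite.exists_fin' R I
  refine Module.finitePresentation_of_surjective p hp ?_
  let v : Fin n → R := fun i => p (Pi.single i 1)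
  have hpv : ∀ c, (p c : R) = ∑ i, c i * v i := by
    intro c
    conv_lhs => rw [pi_eq_sum_univ' c]
    simp [v]
  let P : (Fin n → R[X]) →ₗ[R[X]] R[X] := Fintype.linearCombination R[X] fun i => C (v i)
  have hP : ∀ c, P c = ∑ i, c i * C (v i) := fun c => by
    simp [P, Fintype.linearCombination_apply]
  have := h (LinearMap.range P) (Module.Finite.iff_fg.1 inferInstance)
  have hfg : (LinearMap.ker P).FG := by
    rw [← LinearMap.ker_rangeRestrict]
    exact Module.FinitePresentation.fg_ker _ P.surjective_rangeRestrict
  let ε : (Fin n → R[X]) →ₛₗ[constantCoeff (R := R)] (Fin n → R) :=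
    { toFun := fun c i => constantCoeff (c i)
      map_add' := fun c d => by ext; simp
      map_smul' := fun a c => by ext; simp }
  have : RingHomSurjective (constantCoeff (R := R)) := ⟨fun a => ⟨C a, by simp⟩⟩
  have hmap : LinearMap.ker p = (LinearMap.ker P).map ε := by
    ext c
    constructor
    · intro hc
      have hc : p c = 0 := hc
      refine ⟨fun i => C (c i), ?_, by ext; simp [ε]⟩
      have h1 := hpv c
      rw [hc] at h1
      change P _ = 0
      rw [hP]
      simp only [← C_mul, ← map_sum, ← h1]
      simp
    · rintro ⟨d, hd, rfl⟩
      have hd : P d = 0 := hd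
      rw [hP] at hd
      refine Subtype.ext ?_
      rw [hpv]
      have := congrArg constantCoeff hd
      simpa [ε] using this
  rw [hmap]
  exact hfg.map ε

variable {R : Type u} [CommRing R]

/-- In a coherent Gorenstein ring, finitely generated ideals of the localization at any
prime ideal have finite G-dimension. -/
theorem IsGorenstein.finGDimIdeals (hR : IsCoherent R) (h : IsGorenstein R) (p : Ideal R)
    [hp : p.IsPrime] : FinGDimIdeals (Localization.AtPrime p) := by
  obtain ⟨m, hm, hpm⟩ := Ideal.exists_le_maximal p hp.ne_top
  have hle : m.primeCompl ≤ p.primeCompl := fun x hx hxp => hx (hpm hxp)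
  have h1 : FinGDimIdeals (Localization.AtPrime m) := h m
  have h2 : IsCoherent (Localization.AtPrime m) := hR.localization m.primeCompl
  let _ := IsLocalization.localizationAlgebraOfSubmonoidLe (Localization.AtPrime m)
    (Localization.AtPrime p) m.primeCompl p.primeCompl hle
  have := IsLocalization.localization_isScalarTower_of_submonoid_le (Localization.AtPrime m)
    (Localization.AtPrime p) m.primeCompl p.primeCompl hle
  have := IsLocalization.isLocalization_of_submonoid_le (Localization.AtPrime m)
    (Localization.AtPrime p) m.primeCompl p.primeCompl hle
  exact h1.localization (p.primeCompl.map (algebraMap R (Localization.AtPrime m))) h2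

attribute [local instance] Polynomial.algebra

theorem IsGorenstein.polynomial (hR : IsCoherent R[X]) (h : IsGorenstein R) :
    IsGorenstein R[X] := by
  intro n hn
  -- This contraction is prime but need not be maximal, so the Gorenstein hypothesis reaches `A`
  -- through a further localization.
  let p := n.comap C
  let A := Localization.AtPrime p
  have hAcoh : IsCoherent A := hR.of_polynomial.localization p.primeCompl
  have hA : FinGDimIdeals A := h.finGDimIdeals hR.of_polynomial p
  let W := p.primeCompl.map (C : R →+* R[X])
  have : IsLocalization W A[X] := Polynomial.isLocalization _ _
  let n' := n.map (algebraMap R[X] A[X])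
  have disj : Disjoint (W : Set R[X]) (n : Set R[X]) := by
    rw [Set.disjoint_left]
    rintro _ ⟨a, ha, rfl⟩ hn
    exact ha hn
  have hcomap : n'.comap (algebraMap R[X] A[X]) = n :=
    IsLocalization.under_map_of_isPrime_disjoint W _ hn.isPrime disj
  have : n'.IsPrime := IsLocalization.isPrime_of_isPrime_disjoint W _ _ hn.isPrime disj
  have : (n'.under R[X]).IsMaximal := by
    change (n'.comap (algebraMap R[X] A[X])).IsMaximal
    rwa [hcomap]
  have : n'.IsMaximal := .of_isLocalization_of_disjoint W
  have hn'A : n'.comap C = IsLocalRing.maximalIdeal A := by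
    have h1 : ∀ I : Ideal A, (I.comap (algebraMap R A)).map (algebraMap R A) = I :=
      fun I => IsLocalization.map_under p.primeCompl A I
    rw [← h1 (n'.comap C), ← h1 (IsLocalRing.maximalIdeal A)]
    congr 1
    have h2 : (IsLocalRing.maximalIdeal A).comap (algebraMap R A) = p :=
      IsLocalization.AtPrime.under_maximalIdeal A p
    rw [h2, Ideal.comap_comap]
    have h3 : (C : A →+* A[X]).comp (algebraMap R A) = (algebraMap R[X] A[X]).comp C := by
      ext a
      simp [Polynomial.algebraMap_def]
    rw [h3, ← Ideal.comap_comap, hcomap]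
  have hBcoh : IsCoherent (Localization.AtPrime n') :=
    (hR.localization (B := A[X]) W).localization n'.primeCompl
  have hB := hA.localization_polynomial hAcoh n' hn'A hBcoh
  -- Localizing first at `W` and then at `n'` is localizing `R[X]` at `n`.
  have : IsLocalization.AtPrime (Localization.AtPrime n') n := by
    convert! IsLocalization.isLocalization_isLocalization_atPrime_isLocalization W
      (Localization.AtPrime n') n'
    exact hcomap.symm
  exact hB.of_ringEquiv hBcoh (IsLocalization.algEquiv n.primeCompl
    (Localization.AtPrime n') (Localization.AtPrime n)).toRingEquiv

theorem IsGorenstein.of_polynomial (hR : IsCoherent R[X]) (h : IsGorenstein R[X]) :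
    IsGorenstein R := by
  intro m hm
  let A := Localization.AtPrime m
  let W := m.primeCompl.map (C : R →+* R[X])
  have : IsLocalization W A[X] := Polynomial.isLocalization _ _
  let n' := originIdeal A
  let n := n'.comap (algebraMap R[X] A[X])
  -- Identifies `n` as the ideal generated by `m` and `X`, which is maximal, so the hypothesis on
  -- `R[X]` applies to it.
  have hn : n = m.comap constantCoeff := by
    have h2 : (IsLocalRing.maximalIdeal A).comap (algebraMap R A) = m :=
      IsLocalization.AtPrime.under_maximalIdeal A m
    have h3 : (constantCoeff (R := A)).comp (algebraMap R[X] A[X])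
        = (algebraMap R A).comp constantCoeff := by
      ext <;> simp [Polynomial.algebraMap_def]
    change ((IsLocalRing.maximalIdeal A).comap constantCoeff).comap (algebraMap R[X] A[X]) = _
    rw [Ideal.comap_comap, h3, ← Ideal.comap_comap, h2]
  have hnmax : n.IsMaximal := by
    rw [hn]
    exact Ideal.comap_isMaximal_of_surjective _ fun a => ⟨C a, by simp⟩
  have hBcoh : IsCoherent (Localization.AtPrime n') :=
    (hR.localization (B := A[X]) W).localization n'.primeCompl
  have : IsLocalization.AtPrime (Localization.AtPrime n') n :=
    IsLocalization.isLocalization_isLocalization_atPrime_isLocalization W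
      (Localization.AtPrime n') n'
  have hB : FinGDimIdeals (Localization.AtPrime n') :=
    FinGDimIdeals.of_ringEquiv (hR.localization n.primeCompl) (IsLocalization.algEquiv n.primeCompl
      (Localization.AtPrime n) (Localization.AtPrime n')).toRingEquiv (h n)
  exact FinGDimIdeals.of_localization_polynomial hBcoh hB

end Main
end CohGor

theorem theorem5p10 (R : Type*) [CommRing R]
    (hcoh : CohGor.IsCoherent (Polynomial R)) :
    CohGor.IsGorenstein R ↔ CohGor.IsGorenstein (Polynomial R) :=
  ⟨fun h => h.polynomial hcoh, fun h => h.of_polynomial hcoh⟩
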